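/- Let $N\ge 1$, let $\Omega\subset\mathbb{R}^N$ be a bounded open set with Lipschitz boundary, and let $A:\mathbb{R}^N\to\mathbb{R}^N$ be of class $C^2$. For $z\in\mathbb{C}$ put $|z|_1:=|\Re z|+|\Im z|$. For $u\in L^1(\Omega,\mathbb{C})$ define $|Du|_A(\Omega):=C_{1,A,u}(\Omega)+C_{2,A,u}(\Omega)\in[0,\infty]$, where $$C_{1,A,u}(\Omega):=\sup_{\varphi}\int_\Omega \big(\Re u\,\mathrm{div}\,\varphi-(A\cdot\varphi)\,\Im u\big)\,dx,\qquad C_{2,A,u}(\Omega):=\sup_{\varphi}\int_\Omega \big(\Im u\,\mathrm{div}\,\varphi+(A\cdot\varphi)\,\Re u\big)\,dx,$$ both suprema being taken over all $\varphi\in C_c^\infty(\Omega,\mathbb{R}^N)$ with $\|\varphi\|_{L^\infty(\Omega)}\le 1$, and let $BV_A(\Omega)$ be the set of all $u\in L^1(\Omega,\mathbb{C})$ with $|Du|_A(\Omega)<\infty$. Let $Q_{1,N}:=\int_{\mathbb{S}^{N-1}}|\omega\cdot h|\,d\mathcal{H}^{N-1}(h)$, where $\omega\in\mathbb{R}^N$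 is an arbitrary unit vector. Let $u\in BV_A(\Omega)$ and let $(\rho_m)_{m\in\mathbb{N}}$ be a sequence of non-negative measurable functions on $(0,\infty)$ such that $$\lim_{m\to\infty}\int_0^\infty\rho_m(r)\,r^{N-1}\,dr=1\qquad\text{and}\qquad \lim_{m\to\infty}\int_\delta^\infty\rho_m(r)\,r^{N-1}\,dr=0\quad\text{for every }\delta>0.$$ Then $$\lim_{m\to\infty}\int_\Omega\int_\Omega\frac{\big|u(x)-e^{i(x-y)\cdot A\left(\frac{x+y}{2}\right)}u(y)\big|_1}{|x-y|}\,\rho_m(|x-y|)\,dx\,dy=Q_{1,N}\,|Du|_A(\Omega).$$ -/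

import Mathlib

open MeasureTheory Filter Topology Set
open scoped ENNReal NNReal

noncomputable section

namespace MagneticBV

/-- `ℝ^N` with its Euclidean norm. -/
abbrev Space (N : ℕ) : Type := EuclideanSpace ℝ (Fin N)

/-- The norm `|z|₁ = |Re z| + |Im z|` on `ℂ`. -/
def norm1 (z : ℂ) : ℝ := |z.re| + |z.im|

/-- The divergence of a vector field on `ℝ^N`, that is `∑ i, ∂ᵢ φᵢ`. -/
def divergence {N : ℕ} (φ : Space N → Space N) (x : Space N) : ℝ :=
  ∑ i : Fin N, (fderiv ℝ φ x (EuclideanSpace.single i (1 : ℝ))) i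

/-- The admissible test fields: `φ ∈ C_c^∞(Ω, ℝ^N)` with `‖φ‖_∞ ≤ 1`. -/
structure IsTestField {N : ℕ} (Ω : Set (Space N)) (φ : Space N → Space N) : Prop where
  smooth : ContDiff ℝ ((⊤ : ℕ∞) : WithTop ℕ∞) φ
  compact : HasCompactSupport φ
  support : tsupport φ ⊆ Ω
  bound : ∀ x, ‖φ x‖ ≤ 1

/-- `C_{1,A,u}(Ω)`, the supremum over the test fields of
`∫_Ω Re u div φ - (A · φ) Im u`. The zero field is admissible, so the supremum is nonnegative
and cutting negative integrals off at `0` does not change it. -/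
def variationRe {N : ℕ} (A : Space N → Space N) (u : Space N → ℂ) (Ω : Set (Space N)) : ℝ≥0∞ :=
  ⨆ (φ : Space N → Space N) (_ : IsTestField Ω φ),
    ENNReal.ofReal
      (∫ x in Ω, ((u x).re * divergence φ x - inner ℝ (A x) (φ x) * (u x).im))

/-- `C_{2,A,u}(Ω)`, the supremum over the test fields of
`∫_Ω Im u div φ + (A · φ) Re u`. -/
def variationIm {N : ℕ} (A : Space N → Space N) (u : Space N → ℂ) (Ω : Set (Space N)) : ℝ≥0∞ :=
  ⨆ (φ : Space N → Space N) (_ : IsTestField Ω φ),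
    ENNReal.ofReal
      (∫ x in Ω, ((u x).im * divergence φ x + inner ℝ (A x) (φ x) * (u x).re))

/-- The magnetic total variation `|Du|_A(Ω) = C_{1,A,u}(Ω) + C_{2,A,u}(Ω)`. -/
def variation {N : ℕ} (A : Space N → Space N) (u : Space N → ℂ) (Ω : Set (Space N)) : ℝ≥0∞ :=
  variationRe A u Ω + variationIm A u Ω

/-- `u ∈ BV_A(Ω)`: `u ∈ L¹(Ω, ℂ)` and `|Du|_A(Ω) < ∞`. -/
def MemBV {N : ℕ} (A : Space N → Space N) (u : Space N → ℂ) (Ω : Set (Space N)) : Prop :=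
  IntegrableOn u Ω ∧ variation A u Ω < ⊤

/-- `Ω` has Lipschitz boundary: near each of its boundary points `p`, `Ω` is the set of points
lying strictly above the graph of a Lipschitz function over a hyperplane `ν^⊥`, in the direction
of the unit vector `ν`. The function `γ` is only evaluated at the orthogonal projections
`x - ⟪ν, x⟫ ν` of points `x` on `ν^⊥`. -/
def HasLipschitzBoundary {N : ℕ} (Ω : Set (Space N)) : Prop :=
  ∀ p ∈ frontier Ω, ∃ (ν : Space N) (γ : Space N → ℝ) (K : ℝ≥0) (r : ℝ),
    ‖ν‖ = 1 ∧ LipschitzWith K γ ∧ 0 < r ∧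
      ∀ x ∈ Metric.ball p r, x ∈ Ω ↔ γ (x - (inner ℝ ν x : ℝ) • ν) < inner ℝ ν x

/-- `∫_{S^{N-1}} |ω · h| dℋ^{N-1}(h)`, which is `Q_{1,N}` when `ω` is any unit vector. Here
`volume.toSphere` is the surface measure of the unit sphere, i.e. the `(N-1)`-dimensional Hausdorff
measure in its usual normalization (for `N = 1`, the counting measure on two points). -/
def sphereConst {N : ℕ} (ω : Space N) : ℝ :=
  ∫ h : Metric.sphere (0 : Space N) 1,
    |inner ℝ ω (h : Space N)| ∂((volume : Measure (Space N)).toSphere)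

/-- The magnetic difference `u(x) - e^{i (x - y) · A((x + y) / 2)} u(y)`. -/
def magneticDiff {N : ℕ} (A : Space N → Space N) (u : Space N → ℂ) (x y : Space N) : ℂ :=
  u x - Complex.exp
    (Complex.I * ((inner ℝ (x - y) (A ((1 / 2 : ℝ) • (x + y))) : ℝ) : ℂ)) * u y

/-- The nonlocal energy
`∫_Ω ∫_Ω |u(x) - e^{i (x - y) · A((x + y) / 2)} u(y)|₁ / |x - y| · ρ(|x - y|) dx dy`
in `[0, ∞]`. -/
def energy {N : ℕ} (A : Space N → Space N) (u : Space N → ℂ) (Ω : Set (Space N))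
    (ρ : ℝ → ℝ) : ℝ≥0∞ :=
  ∫⁻ y in Ω, ∫⁻ x in Ω,
    ENNReal.ofReal (norm1 (magneticDiff A u x y) / ‖x - y‖ * ρ ‖x - y‖)

end MagneticBV

end

noncomputable section

namespace MagneticBV

variable {N : ℕ}

/-! Substituting `x = y + r h` with `|h| = 1`, polar coordinates turn the energy into `∫ ρ_m(r)
r^(N-1) T(r) dr`. Here `T` is `magneticQuotient`: the integral over `h` and over `y` with `y, y + r
h ∈ Ω` of the magnetic difference divided by `r`. The weights concentrate at `0` and `T` is bounded
on each `(δ, ∞)`, so it suffices that `T(r) → Q |Du|_A(Ω)` as `r → 0+`.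

On the bounded set `Ω` the magnetic difference is `u(y + k) - u(y) - i (k · A(y)) u(y)` up to
`O(|k|² |u(y)|)`. Its real and imaginary parts are increments `f(y + k) - f(y) + k · G(y)`, with
`(f, G) = (Re u, (Im u) A)` and `(Im u, -(Re u) A)`. Both `|·|₁` and `|Du|_A` split accordingly, and
`C_1`, `C_2` are the total variations on `Ω` of the distributions `∇f + G`. What remains is one real
statement, `tendsto_sphereQuotient`. For smooth pairs it rests on `∫ |h · v| dh = Q |v|`; in general
on mollification.

Lower bound (`le_liminf_sphereQuotient`): mollification commutes with increments and does not raise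
their `L¹` norm, Fatou handles the smooth pair, and testing against a fixed field recovers the total
variation.

Upper bound (`eventually_sphereQuotient_le`): away from the boundary, increments are integrals of
the covariant gradient along segments, and `lintegral_enorm_covGrad_mollify_le` bounds the mass of
the mollified gradient. Near the boundary a segment may leave `Ω`; the Lipschitz condition provides
a detour of comparable length inside a thin layer (`exists_shiftBound_ball`), and the variation in
thin layers is small (`exists_totalVariation_boundaryLayer_le`). -/

/-- The surface measure of the unit sphere of `ℝ^N`. -/
abbrev sphereMeasure (N : ℕ) : Measure (Metric.sphere (0 : Space N) 1) :=
  (volume : Measure (Space N)).toSphere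

/-! ### Polar coordinates and averages over the unit sphere -/

theorem nontrivial_space {N : ℕ} (hN : 1 ≤ N) : Nontrivial (Space N) := by
  have : Nonempty (Fin N) := ⟨⟨0, hN⟩⟩
  infer_instance

theorem lintegral_polar {N : ℕ} (hN : 1 ≤ N) {F : Space N → ℝ≥0∞} (hF : Measurable F) :
    ∫⁻ x, F x = ∫⁻ r in Ioi (0 : ℝ), ENNReal.ofReal (r ^ (N - 1)) *
      ∫⁻ h : Metric.sphere (0 : Space N) 1, F (r • (h : Space N)) ∂(sphereMeasure N) := by
  have := nontrivial_space hN
  have hdim : Module.finrank ℝ (Space N) = N := finrank_euclideanSpace_fin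
  have hmp := (volume : Measure (Space N)).measurePreserving_homeomorphUnitSphereProd
  rw [hdim] at hmp
  have hG : Measurable fun p : Metric.sphere (0 : Space N) 1 × Ioi (0 : ℝ) =>
      F ((p.2 : ℝ) • (p.1 : Space N)) := by fun_prop
  calc ∫⁻ x, F x = ∫⁻ x in ({0}ᶜ : Set (Space N)), F x := by
        rw [restrict_compl_singleton]
    _ = ∫⁻ x : ({0}ᶜ : Set (Space N)), F x ∂((volume : Measure (Space N)).comap (↑)) :=
        (lintegral_subtype_comap (measurableSet_singleton _).compl _).symm
    _ = ∫⁻ x : ({0}ᶜ : Set (Space N)), (fun p : Metric.sphere (0 : Space N) 1 × Ioi (0 : ℝ) =>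
          F ((p.2 : ℝ) • (p.1 : Space N))) (homeomorphUnitSphereProd (Space N) x)
          ∂((volume : Measure (Space N)).comap (↑)) := by
        refine lintegral_congr fun x => ?_
        have hx : ‖(x : Space N)‖ ≠ 0 := norm_ne_zero_iff.2 x.2
        simp [smul_smul, hx]
    _ = ∫⁻ p, F ((p.2 : ℝ) • (p.1 : Space N))
          ∂((sphereMeasure N).prod (Measure.volumeIoiPow (N - 1))) :=
        hmp.lintegral_comp hG
    _ = ∫⁻ r, ∫⁻ h, F ((r : ℝ) • (h : Space N)) ∂(sphereMeasure N)
          ∂(Measure.volumeIoiPow (N - 1)) := lintegral_prod_symm _ hG.aemeasurable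
    _ = _ := by
        rw [Measure.volumeIoiPow, lintegral_withDensity_eq_lintegral_mul _ (by fun_prop)
          (Measurable.lintegral_prod_left' (f := fun p : Metric.sphere (0 : Space N) 1 ×
            Ioi (0 : ℝ) => F ((p.2 : ℝ) • (p.1 : Space N))) hG)]
        exact lintegral_subtype_comap measurableSet_Ioi (fun r : ℝ => ENNReal.ofReal (r ^ (N - 1)) *
          ∫⁻ h : Metric.sphere (0 : Space N) 1, F (r • (h : Space N)) ∂(sphereMeasure N))

/-- In polar coordinates a null set of radii sweeps out a null set of points. This lets an a.e.
measurable radial weight be replaced by a measurable one. -/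
theorem ae_norm_of_ae {N : ℕ} (hN : 1 ≤ N) {p : ℝ → Prop}
    (hp : ∀ᵐ r ∂(volume.restrict (Ioi (0 : ℝ))), p r) :
    ∀ᵐ x : Space N, x ≠ 0 → p ‖x‖ := by
  obtain ⟨s, hs, hsm, hs0⟩ := exists_measurable_superset_of_null (ae_iff.1 hp)
  have hm : Measurable fun x : Space N => s.indicator (fun _ => (1 : ℝ≥0∞)) ‖x‖ :=
    (measurable_const.indicator hsm).comp measurable_norm
  have h0 : ∫⁻ x : Space N, s.indicator (fun _ => (1 : ℝ≥0∞)) ‖x‖ = 0 := by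
    rw [lintegral_polar hN hm]
    rw [lintegral_eq_zero_iff']
    · have : ∀ᵐ r ∂(volume.restrict (Ioi (0 : ℝ))), r ∉ s := by
        rw [ae_iff]; simpa using hs0
      filter_upwards [this, ae_restrict_mem measurableSet_Ioi] with r hr hr0
      have : ∀ h : Metric.sphere (0 : Space N) 1, ‖r • (h : Space N)‖ = r := fun h => by
        simp [norm_smul, abs_of_pos (show 0 < r from hr0)]
      simp [this, hr]
    · refine Measurable.aemeasurable (Measurable.mul (by fun_prop) ?_)
      refine Measurable.lintegral_prod_left' (f := fun q : Metric.sphere (0 : Space N) 1 × ℝ =>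
        s.indicator (fun _ => (1 : ℝ≥0∞)) ‖q.2 • (q.1 : Space N)‖) ?_
      exact (measurable_const.indicator hsm).comp (by fun_prop)
  rw [lintegral_eq_zero_iff hm] at h0
  filter_upwards [h0] with x hx _
  by_contra hpx
  have : ‖x‖ ∈ s := hs hpx
  simp [this] at hx

/-- A reflection carries `ω` to `ω'` and preserves Lebesgue measure. The integral of `|x · v|` over
the unit ball is a positive finite radial factor times the spherical integral, so the invariance
passes to the sphere after cancelling that factor. -/
theorem lintegral_sphere_enorm_inner_congr {N : ℕ} (hN : 1 ≤ N) {ω ω' : Space N}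
    (h : ‖ω‖ = ‖ω'‖) :
    ∫⁻ z : Metric.sphere (0 : Space N) 1, ‖(inner ℝ (z : Space N) ω : ℝ)‖ₑ ∂(sphereMeasure N) =
      ∫⁻ z : Metric.sphere (0 : Space N) 1, ‖(inner ℝ (z : Space N) ω' : ℝ)‖ₑ
        ∂(sphereMeasure N) := by
  have hmr : Measurable fun r : ℝ => ENNReal.ofReal (r ^ (N - 1)) *
      (Iio (1 : ℝ)).indicator (fun r => ENNReal.ofReal r) r :=
    Measurable.mul (by fun_prop) (Measurable.indicator (by fun_prop) measurableSet_Iio)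
  have hball : ∀ v : Space N, ∫⁻ x : Space N, (Metric.ball (0 : Space N) 1).indicator
      (fun x => ‖(inner ℝ x v : ℝ)‖ₑ) x =
      (∫⁻ r in Ioi (0 : ℝ), ENNReal.ofReal (r ^ (N - 1)) *
        (Iio (1 : ℝ)).indicator (fun r => ENNReal.ofReal r) r) *
      ∫⁻ z : Metric.sphere (0 : Space N) 1, ‖(inner ℝ (z : Space N) v : ℝ)‖ₑ
        ∂(sphereMeasure N) := by
    intro v
    rw [lintegral_polar hN (Measurable.indicator (by fun_prop) measurableSet_ball),
      ← lintegral_mul_const _ hmr]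
    refine setLIntegral_congr_fun measurableSet_Ioi fun r hr => ?_
    have hr0 : 0 < r := hr
    rw [mul_assoc]
    congr 1
    rw [← lintegral_const_mul' _ _ (by
      by_cases h : r ∈ Iio (1 : ℝ) <;> simp [h])]
    refine lintegral_congr fun z => ?_
    have hz : ‖r • (z : Space N)‖ = r := by simp [norm_smul, abs_of_pos hr0]
    by_cases h1 : r < 1
    · rw [indicator_of_mem (by simpa [mem_ball_zero_iff, hz] using h1),
        indicator_of_mem (by exact h1), real_inner_smul_left, enorm_mul,
        Real.enorm_of_nonneg hr0.le]
    · rw [indicator_of_notMem (by simpa [mem_ball_zero_iff, hz] using h1),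
        indicator_of_notMem (by exact h1), zero_mul]
  have hinv : ∫⁻ x : Space N, (Metric.ball (0 : Space N) 1).indicator
      (fun x => ‖(inner ℝ x ω : ℝ)‖ₑ) x = ∫⁻ x : Space N, (Metric.ball (0 : Space N) 1).indicator
      (fun x => ‖(inner ℝ x ω' : ℝ)‖ₑ) x := by
    set L := (ℝ ∙ (ω - ω'))ᗮ.reflection
    have hLω : L ω = ω' := Submodule.reflection_sub h
    rw [← (L.measurePreserving).lintegral_comp (f := (Metric.ball (0 : Space N) 1).indicator
      (fun x => ‖(inner ℝ x ω' : ℝ)‖ₑ)) (Measurable.indicator (by fun_prop) measurableSet_ball)]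
    refine lintegral_congr fun x => ?_
    by_cases hx : ‖x‖ < 1
    · rw [indicator_of_mem (by simpa using hx), indicator_of_mem (by simpa using hx), ← hLω,
        L.inner_map_map]
    · rw [indicator_of_notMem (by simpa using hx), indicator_of_notMem (by simpa using hx)]
  rw [hball, hball] at hinv
  refine (ENNReal.mul_right_inj ?_ ?_).1 hinv
  · rw [Ne, lintegral_eq_zero_iff hmr]
    intro h0
    have h1 : volume.restrict (Ioi (0 : ℝ)) (Ioo 0 1) = 0 := by
      refine measure_mono_null ?_ (ae_iff.1 h0)
      intro r hr
      have : (0 : ℝ) < r ^ (N - 1) := pow_pos hr.1 _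
      simp [hr.2, hr.1, this]
    rw [Measure.restrict_apply measurableSet_Ioo, inter_eq_left.2 Ioo_subset_Ioi_self] at h1
    simp at h1
  · refine ne_of_lt (lt_of_le_of_lt (b := ∫⁻ r in Ioi (0 : ℝ), (Ioo (0 : ℝ) 1).indicator 1 r) ?_ ?_)
    · refine setLIntegral_mono' measurableSet_Ioi fun r hr => ?_
      have hr0 : 0 < r := hr
      by_cases h1 : r < 1
      · rw [indicator_of_mem (by exact h1), indicator_of_mem (by exact ⟨hr0, h1⟩),
          ← ENNReal.ofReal_mul (pow_nonneg hr0.le _), Pi.one_apply, ENNReal.ofReal_le_one]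
        exact mul_le_one₀ (pow_le_one₀ hr0.le h1.le) hr0.le h1.le
      · rw [indicator_of_notMem (by exact h1), mul_zero]
        exact zero_le
    · rw [lintegral_indicator_one measurableSet_Ioo]
      exact lt_of_le_of_lt (Measure.restrict_apply_le _ _) (by simp)

theorem lintegral_sphere_enorm_inner {N : ℕ} (hN : 1 ≤ N) {ω : Space N} (hω : ‖ω‖ = 1)
    (v : Space N) :
    ∫⁻ z : Metric.sphere (0 : Space N) 1, ‖(inner ℝ (z : Space N) v : ℝ)‖ₑ ∂(sphereMeasure N) =
      ENNReal.ofReal (sphereConst ω) * ‖v‖ₑ := by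
  have h1 : ENNReal.ofReal (sphereConst ω) =
      ∫⁻ z : Metric.sphere (0 : Space N) 1, ‖(inner ℝ (z : Space N) ω : ℝ)‖ₑ
        ∂(sphereMeasure N) := by
    have hint : Integrable (fun z : Metric.sphere (0 : Space N) 1 =>
        (inner ℝ ω (z : Space N) : ℝ)) (sphereMeasure N) := by
      refine Integrable.of_bound (Continuous.aestronglyMeasurable (by fun_prop)) 1
        (Eventually.of_forall fun z => ?_)
      refine (norm_inner_le_norm _ _).trans ?_
      simp [hω]
    have := ofReal_integral_norm_eq_lintegral_enorm hint
    simp only [Real.norm_eq_abs] at this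
    rw [sphereConst, this]
    exact lintegral_congr fun z => by rw [real_inner_comm]
  rw [lintegral_sphere_enorm_inner_congr hN (ω' := ‖v‖ • ω) (by simp [norm_smul, hω]), h1,
    ← lintegral_mul_const' _ _ enorm_ne_top]
  refine lintegral_congr fun z => ?_
  rw [real_inner_smul_right, enorm_mul, enorm_norm, mul_comm]

/-! ### Concentrating weights -/

/-- Weights concentrating at the origin average a function to its limit there. -/
theorem tendsto_lintegral_mul_of_concentrating {w : ℕ → ℝ → ℝ≥0∞} {T : ℝ → ℝ≥0∞} {L : ℝ≥0∞}
    (hw1 : Tendsto (fun m => ∫⁻ r in Ioi (0 : ℝ), w m r) atTop (𝓝 1))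
    (hwδ : ∀ δ : ℝ, 0 < δ → Tendsto (fun m => ∫⁻ r in Ioi δ, w m r) atTop (𝓝 0))
    (hT : Tendsto T (𝓝[>] 0) (𝓝 L))
    (hTb : ∀ δ : ℝ, 0 < δ → ∃ B : ℝ≥0∞, B ≠ ∞ ∧ ∀ r, δ < r → T r ≤ B) :
    Tendsto (fun m => ∫⁻ r in Ioi (0 : ℝ), w m r * T r) atTop (𝓝 L) := by
  have hsplit : ∀ δ : ℝ, 0 < δ → ∀ F : ℝ → ℝ≥0∞, ∫⁻ r in Ioi (0 : ℝ), F r =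
      (∫⁻ r in Ioc (0 : ℝ) δ, F r) + ∫⁻ r in Ioi δ, F r := by
    intro δ hδ F
    rw [← Ioc_union_Ioi_eq_Ioi hδ.le, lintegral_union measurableSet_Ioi]
    exact Set.disjoint_left.2 fun x hx hx' => not_lt.2 hx.2 hx'
  refine tendsto_order.2 ⟨fun a ha => ?_, fun b hb => ?_⟩
  · obtain ⟨c, hac, hcL⟩ := exists_between ha
    obtain ⟨δ, hδ, hδT⟩ := (mem_nhdsGT_iff_exists_Ioc_subset).1 (hT.eventually (lt_mem_nhds hcL))
    have hδ : 0 < δ := hδ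
    -- Total mass minus tail tends to `1` and bounds the mass of `(0, δ]` from below.
    have hlim : Tendsto (fun m => c * ((∫⁻ r in Ioi (0 : ℝ), w m r) - ∫⁻ r in Ioi δ, w m r))
        atTop (𝓝 c) := by
      have := ENNReal.Tendsto.sub hw1 (hwδ δ hδ) (Or.inl ENNReal.one_ne_top)
      simpa using ENNReal.Tendsto.const_mul this (Or.inr (hcL.ne_top))
    filter_upwards [hlim.eventually (lt_mem_nhds hac)] with m hm
    refine hm.trans_le ?_
    calc c * ((∫⁻ r in Ioi (0 : ℝ), w m r) - ∫⁻ r in Ioi δ, w m r)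
        ≤ c * ∫⁻ r in Ioc (0 : ℝ) δ, w m r := by
          gcongr
          rw [hsplit δ hδ, tsub_le_iff_right]
      _ = ∫⁻ r in Ioc (0 : ℝ) δ, c * w m r := by
          rw [lintegral_const_mul' _ _ hcL.ne_top]
      _ ≤ ∫⁻ r in Ioc (0 : ℝ) δ, w m r * T r := by
          refine setLIntegral_mono' measurableSet_Ioc fun r hr => ?_
          rw [mul_comm]
          gcongr
          exact (hδT hr).le
      _ ≤ ∫⁻ r in Ioi (0 : ℝ), w m r * T r := lintegral_mono_set Ioc_subset_Ioi_self
  · obtain ⟨c, hLc, hcb⟩ := exists_between hb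
    obtain ⟨δ, hδ, hδT⟩ := (mem_nhdsGT_iff_exists_Ioc_subset).1 (hT.eventually (gt_mem_nhds hLc))
    have hδ : 0 < δ := hδ
    obtain ⟨B, hB, hTB⟩ := hTb δ hδ
    have hlim : Tendsto (fun m => c * (∫⁻ r in Ioi (0 : ℝ), w m r) + B * ∫⁻ r in Ioi δ, w m r)
        atTop (𝓝 c) := by
      have h1 := ENNReal.Tendsto.const_mul hw1 (Or.inr hcb.ne_top)
      have h2 := ENNReal.Tendsto.const_mul (hwδ δ hδ) (Or.inr hB)
      simpa using h1.add h2
    filter_upwards [hlim.eventually (gt_mem_nhds hcb)] with m hm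
    refine lt_of_le_of_lt ?_ hm
    rw [hsplit δ hδ]
    refine add_le_add ?_ ?_
    · rw [← lintegral_const_mul' _ _ hcb.ne_top]
      refine le_trans ?_ (lintegral_mono_set (Ioc_subset_Ioi_self (a := δ)))
      refine setLIntegral_mono' measurableSet_Ioc fun r hr => ?_
      rw [mul_comm]
      gcongr
      exact (hδT hr).le
    · rw [← lintegral_const_mul' _ _ hB]
      refine setLIntegral_mono' measurableSet_Ioi fun r hr => ?_
      rw [mul_comm]
      gcongr
      exact hTB r hr

/-! ### Divergence and the total variation of `∇f + G` -/

theorem divergence_eq_sum {φ : Space N → Space N} {x : Space N} (hφ : DifferentiableAt ℝ φ x) :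
    divergence φ x = ∑ i : Fin N,
      fderiv ℝ (fun y => φ y i) x (EuclideanSpace.single i (1 : ℝ)) := by
  refine Finset.sum_congr rfl fun i _ => ?_
  have h := ((EuclideanSpace.proj (𝕜 := ℝ) (ι := Fin N) i).hasFDerivAt
    (x := φ x)).comp x hφ.hasFDerivAt
  have h' : fderiv ℝ (fun y => φ y i) x = _ := h.fderiv
  rw [h']
  rfl

theorem continuous_divergence {φ : Space N → Space N} (hφ : ContDiff ℝ 1 φ) :
    Continuous (divergence φ) := by
  have h := hφ.continuous_fderiv one_ne_zero
  unfold divergence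
  fun_prop

theorem hasCompactSupport_divergence {φ : Space N → Space N} (hc : HasCompactSupport φ) :
    HasCompactSupport (divergence φ) := by
  refine (hc.fderiv ℝ).mono fun x hx => ?_
  contrapose! hx
  rw [Function.notMem_support] at hx ⊢
  simp [divergence, hx]

theorem divergence_translate (φ : Space N → Space N) (t x : Space N) :
    divergence (fun y => φ (y + t)) x = divergence φ (x + t) := by
  simp [divergence, fderiv_comp_add_right]

theorem divergence_add {φ ψ : Space N → Space N} (hφ : ContDiff ℝ 1 φ) (hψ : ContDiff ℝ 1 ψ)
    (x : Space N) : divergence (fun y => φ y + ψ y) x = divergence φ x + divergence ψ x := by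
  have h := fderiv_fun_add (hφ.differentiable one_ne_zero x) (hψ.differentiable one_ne_zero x)
  simp [divergence, h, Finset.sum_add_distrib]

theorem exists_bound {X F : Type*} [TopologicalSpace X] [NormedAddCommGroup F] {φ : X → F}
    (hφ : Continuous φ) (hc : HasCompactSupport φ) : ∃ C : ℝ, ∀ x, ‖φ x‖ ≤ C :=
  hc.exists_bound_of_continuous hφ

/-- The pairing `∫ f div φ - G · φ` of the distribution `-(∇f + G)` with the field `φ`. -/
def pairing (f : Space N → ℝ) (G φ : Space N → Space N) : ℝ :=
  ∫ x, (f x * divergence φ x - inner ℝ (G x) (φ x))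

/-- The total variation of the distribution `∇f + G` on `W`. -/
def totalVariation (f : Space N → ℝ) (G : Space N → Space N) (W : Set (Space N)) : ℝ≥0∞ :=
  ⨆ (φ : Space N → Space N) (_ : IsTestField W φ), ENNReal.ofReal (pairing f G φ)

theorem IsTestField.contDiff_one {W : Set (Space N)} {φ : Space N → Space N}
    (hφ : IsTestField W φ) : ContDiff ℝ 1 φ := hφ.smooth.of_le (by exact_mod_cast le_top)

theorem IsTestField.mono {W W' : Set (Space N)} {φ : Space N → Space N}
    (hφ : IsTestField W φ) (h : W ⊆ W') : IsTestField W' φ :=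
  ⟨hφ.smooth, hφ.compact, hφ.support.trans h, hφ.bound⟩

theorem totalVariation_mono (f : Space N → ℝ) (G : Space N → Space N) {W W' : Set (Space N)}
    (h : W ⊆ W') : totalVariation f G W ≤ totalVariation f G W' :=
  iSup₂_le fun φ hφ => le_iSup₂_of_le φ (hφ.mono h) le_rfl

theorem pairing_le_totalVariation {f : Space N → ℝ} {G φ : Space N → Space N}
    {W : Set (Space N)} (h : totalVariation f G W ≠ ∞) (hφ : IsTestField W φ) :
    pairing f G φ ≤ (totalVariation f G W).toReal := by
  refine (ENNReal.ofReal_le_iff_le_toReal h).1 ?_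
  exact le_iSup₂_of_le φ hφ le_rfl

theorem integrable_mul_divergence {f : Space N → ℝ} (hf : Integrable f)
    {φ : Space N → Space N} (hφ : ContDiff ℝ 1 φ) (hc : HasCompactSupport φ) :
    Integrable fun x => f x * divergence φ x := by
  obtain ⟨C, hC⟩ := exists_bound (continuous_divergence hφ) (hasCompactSupport_divergence hc)
  exact hf.mul_bdd (continuous_divergence hφ).aestronglyMeasurable (Eventually.of_forall hC)

theorem integrable_inner_field {G : Space N → Space N} (hG : Integrable G)
    {φ : Space N → Space N} (hφ : ContDiff ℝ 1 φ) (hc : HasCompactSupport φ) :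
    Integrable fun x => (inner ℝ (G x) (φ x) : ℝ) := by
  obtain ⟨C, hC⟩ := exists_bound hφ.continuous hc
  refine (hG.norm.mul_const C).mono'
    (hG.aestronglyMeasurable.inner hφ.continuous.aestronglyMeasurable)
    (Eventually.of_forall fun x => ?_)
  refine (norm_inner_le_norm _ _).trans ?_
  gcongr
  exact hC x

theorem integrable_pairing {f : Space N → ℝ} {G : Space N → Space N} (hf : Integrable f)
    (hG : Integrable G) {φ : Space N → Space N} (hφ : ContDiff ℝ 1 φ)
    (hc : HasCompactSupport φ) :
    Integrable fun x => f x * divergence φ x - inner ℝ (G x) (φ x) :=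
  (integrable_mul_divergence hf hφ hc).sub (integrable_inner_field hG hφ hc)

theorem pairing_add {f : Space N → ℝ} {G : Space N → Space N} (hf : Integrable f)
    (hG : Integrable G) {φ ψ : Space N → Space N} (hφ : ContDiff ℝ 1 φ)
    (hc : HasCompactSupport φ) (hψ : ContDiff ℝ 1 ψ) (hc' : HasCompactSupport ψ) :
    pairing f G (fun x => φ x + ψ x) = pairing f G φ + pairing f G ψ := by
  rw [pairing, pairing, pairing,
    ← integral_add (integrable_pairing hf hG hφ hc) (integrable_pairing hf hG hψ hc')]
  refine integral_congr_ae (Eventually.of_forall fun x => ?_)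
  simp only [divergence_add hφ hψ, inner_add_right]
  ring

/-- Since `|φ| ≤ 1`, dropping `G` costs at most its `L¹` norm. It makes the plain variation of `f`
finite, which is what the boundary estimates use. -/
theorem totalVariation_zero_le {f : Space N → ℝ} {G : Space N → Space N} (hf : Integrable f)
    (hG : Integrable G) (W : Set (Space N)) :
    totalVariation f 0 W ≤ totalVariation f G W + ∫⁻ x, ‖G x‖ₑ := by
  refine iSup₂_le fun φ hφ => ?_
  have h1 : pairing f 0 φ = pairing f G φ + ∫ x, (inner ℝ (G x) (φ x) : ℝ) := by
    rw [pairing, pairing, ← integral_add (integrable_pairing hf hG hφ.contDiff_one hφ.compact)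
      (integrable_inner_field hG hφ.contDiff_one hφ.compact)]
    simp
  have h2 : (∫ x, (inner ℝ (G x) (φ x) : ℝ)) ≤ ∫ x, ‖G x‖ := by
    refine integral_mono (integrable_inner_field hG hφ.contDiff_one hφ.compact) hG.norm fun x => ?_
    refine (real_inner_le_norm _ _).trans ?_
    exact mul_le_of_le_one_right (norm_nonneg _) (hφ.bound x)
  rw [h1]
  refine ENNReal.ofReal_add_le.trans (add_le_add (le_iSup₂_of_le φ hφ le_rfl) ?_)
  rw [← ofReal_integral_norm_eq_lintegral_enorm hG]
  exact ENNReal.ofReal_le_ofReal h2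

theorem pairing_translate (f : Space N → ℝ) (G φ : Space N → Space N) (t : Space N) :
    ∫ x, (f (x - t) * divergence φ x - inner ℝ (G (x - t)) (φ x)) =
      pairing f G (fun x => φ (x + t)) := by
  rw [pairing, ← integral_add_right_eq_self _ t]
  simp [divergence_translate]

/-! ### Smooth pairs and integration by parts -/

/-- The covariant gradient `∇g + H`. -/
def covGrad (g : Space N → ℝ) (H : Space N → Space N) (x : Space N) : Space N :=
  gradient g x + H x

theorem inner_covGrad (g : Space N → ℝ) (H : Space N → Space N) (x v : Space N) :
    inner ℝ (covGrad g H x) v = fderiv ℝ g x v + inner ℝ (H x) v := by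
  rw [covGrad, inner_add_left, inner_gradient_left]

theorem contDiff_covGrad {g : Space N → ℝ} {H : Space N → Space N}
    (hg : ContDiff ℝ (⊤ : ℕ∞) g) (hH : ContDiff ℝ (⊤ : ℕ∞) H) :
    ContDiff ℝ (⊤ : ℕ∞) (covGrad g H) := by
  have h1 : ContDiff ℝ (⊤ : ℕ∞) (fderiv ℝ g) := hg.fderiv_right (by simp)
  exact ((InnerProductSpace.toDual ℝ (Space N)).symm.contDiff.comp h1).add hH

theorem continuous_covGrad {g : Space N → ℝ} {H : Space N → Space N}
    (hg : ContDiff ℝ 1 g) (hH : Continuous H) : Continuous (covGrad g H) :=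
  ((InnerProductSpace.toDual ℝ (Space N)).symm.continuous.comp
    (hg.continuous_fderiv one_ne_zero)).add hH

/-- Integration by parts in each coordinate, without boundary terms because `φ` has compact support.
-/
theorem pairing_eq_neg_integral_inner_covGrad {g : Space N → ℝ} {H φ : Space N → Space N}
    (hg : ContDiff ℝ 1 g) (hH : Continuous H) (hφ : ContDiff ℝ 1 φ)
    (hc : HasCompactSupport φ) :
    pairing g H φ = -∫ x, (inner ℝ (covGrad g H x) (φ x) : ℝ) := by
  have hφi : ∀ i, ContDiff ℝ 1 fun x => φ x i := fun i =>
    (EuclideanSpace.proj (𝕜 := ℝ) (ι := Fin N) i).contDiff.comp hφ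
  have hci : ∀ i, HasCompactSupport fun x => φ x i := fun i =>
    hc.comp_left (g := fun v : Space N => v i) rfl
  have hci' : ∀ i, HasCompactSupport fun x => fderiv ℝ (fun y => φ y i) x
      (EuclideanSpace.single i (1 : ℝ)) := fun i =>
    ((hci i).fderiv ℝ).comp_left (g := fun l : Space N →L[ℝ] ℝ =>
      l (EuclideanSpace.single i (1 : ℝ))) rfl
  have hgc := hg.continuous_fderiv one_ne_zero
  have hφc : ∀ i, Continuous (fderiv ℝ fun y => φ y i) := fun i =>
    (hφi i).continuous_fderiv one_ne_zero
  have hgcont := hg.continuous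
  have hφcont := hφ.continuous
  have hi1 : ∀ i, Integrable fun x => g x * fderiv ℝ (fun y => φ y i) x
      (EuclideanSpace.single i (1 : ℝ)) := fun i => by
    have := hφc i
    exact Continuous.integrable_of_hasCompactSupport (by fun_prop) (hci' i).mul_left
  have hi2 : ∀ i, Integrable fun x => fderiv ℝ g x (EuclideanSpace.single i (1 : ℝ)) * φ x i :=
    fun i => Continuous.integrable_of_hasCompactSupport (by fun_prop) (hci i).mul_left
  have hi3 : ∀ i, Integrable fun x => g x * φ x i :=
    fun i => Continuous.integrable_of_hasCompactSupport (by fun_prop) (hci i).mul_left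
  have hiH : Integrable fun x => (inner ℝ (H x) (φ x) : ℝ) :=
    Continuous.integrable_of_hasCompactSupport (by fun_prop) (hc.mono fun x hx => by
      contrapose! hx
      rw [Function.notMem_support] at hx ⊢
      simp [hx])
  have hsum : ∀ x, fderiv ℝ g x (φ x) =
      ∑ i, fderiv ℝ g x (EuclideanSpace.single i (1 : ℝ)) * φ x i := fun x => by
    conv_lhs => rw [← (EuclideanSpace.basisFun (Fin N) ℝ).sum_repr (φ x), map_sum]
    simp [mul_comm]
  have hig : Integrable fun x => fderiv ℝ g x (φ x) := by
    simp only [hsum]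
    exact integrable_finsetSum _ fun i _ => hi2 i
  have hdiv : ∀ x, g x * divergence φ x = ∑ i, g x * fderiv ℝ (fun y => φ y i) x
      (EuclideanSpace.single i (1 : ℝ)) := fun x => by
    rw [divergence_eq_sum (hφ.differentiable one_ne_zero x), Finset.mul_sum]
  have hint : Integrable fun x => g x * divergence φ x := by
    simp only [hdiv]
    exact integrable_finsetSum _ fun i _ => hi1 i
  simp only [inner_covGrad]
  rw [integral_add hig hiH, pairing, integral_sub hint hiH, neg_add, ← sub_eq_add_neg]
  congr 1
  simp only [hdiv, hsum]
  rw [integral_finsetSum _ fun i _ => hi1 i, integral_finsetSum _ fun i _ => hi2 i,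
    ← Finset.sum_neg_distrib]
  refine Finset.sum_congr rfl fun i _ => ?_
  exact integral_mul_fderiv_eq_neg_fderiv_mul_of_integrable (hi2 i) (hi1 i) (hi3 i)
    (fun x _ => hg.differentiable one_ne_zero x) (fun x _ => (hφi i).differentiable one_ne_zero x)

/-! ### Mollification -/

theorem setLIntegral_comp_add_le (F : Space N → ℝ≥0∞) {K K' : Set (Space N)}
    (hK : MeasurableSet K) (hK' : MeasurableSet K') {t : Space N}
    (h : ∀ y ∈ K, y + t ∈ K') : ∫⁻ y in K, F (y + t) ≤ ∫⁻ y in K', F y := by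
  rw [← lintegral_indicator hK, ← lintegral_indicator hK',
    ← lintegral_add_right_eq_self (K'.indicator F) t]
  refine lintegral_mono fun y => ?_
  by_cases hy : y ∈ K
  · rw [indicator_of_mem hy, indicator_of_mem (h y hy)]
  · rw [indicator_of_notMem hy]
    exact zero_le

/-- The mollification `∫ η(t) f(x - t) dt` of `f` by the normalized bump function `η`. -/
def mollify {F : Type*} [NormedAddCommGroup F] [NormedSpace ℝ F] (η : ContDiffBump (0 : Space N))
    (f : Space N → F) (x : Space N) : F :=
  ∫ t, η.normed volume t • f (x - t)

section Mollify

variable {F : Type*} [NormedAddCommGroup F] [NormedSpace ℝ F] (η : ContDiffBump (0 : Space N))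

theorem mollify_eq_convolution (f : Space N → F) :
    mollify η f = convolution (η.normed volume) f (ContinuousLinearMap.lsmul ℝ ℝ) volume := rfl

theorem contDiff_mollify [CompleteSpace F] {f : Space N → F} (hf : Integrable f) :
    ContDiff ℝ (⊤ : ℕ∞) (mollify η f) := by
  rw [mollify_eq_convolution]
  exact η.hasCompactSupport_normed.contDiff_convolution_left _ η.contDiff_normed
    hf.locallyIntegrable

theorem integrable_mollify_integrand {f : Space N → F} (hf : Integrable f) (x : Space N) :
    Integrable fun t => η.normed volume t • f (x - t) := by
  obtain ⟨C, hC⟩ := exists_bound (η.continuous_normed (μ := volume)) η.hasCompactSupport_normed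
  exact (hf.comp_sub_left x).bdd_smul C η.continuous_normed.aestronglyMeasurable
    (Eventually.of_forall hC)

theorem lintegral_enorm_normed : ∫⁻ t, ‖η.normed (volume : Measure (Space N)) t‖ₑ = 1 := by
  have h := ofReal_integral_norm_eq_lintegral_enorm (η.integrable_normed (μ := volume))
  rw [← h]
  simp only [Real.norm_of_nonneg (η.nonneg_normed _), η.integral_normed, ENNReal.ofReal_one]

/-- A mollification averages, with total weight one, translates by vectors of length at most
`η.rOut`; each of them maps `K` into `K'`. Tonelli does the rest. -/
theorem lintegral_enorm_mollify_le {f : Space N → F} (hf : StronglyMeasurable f)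
    {K K' : Set (Space N)} (hK : MeasurableSet K) (hK' : MeasurableSet K')
    (hKK' : ∀ y ∈ K, ∀ t, ‖t‖ ≤ η.rOut → y - t ∈ K') :
    ∫⁻ y in K, ‖mollify η f y‖ₑ ≤ ∫⁻ y in K', ‖f y‖ₑ := by
  have hfm : Measurable fun y => ‖f y‖ₑ := hf.enorm
  have hηm : Measurable fun t => ‖η.normed (volume : Measure (Space N)) t‖ₑ :=
    η.continuous_normed.measurable.enorm
  calc ∫⁻ y in K, ‖mollify η f y‖ₑ
      ≤ ∫⁻ y in K, ∫⁻ t, ‖η.normed (volume : Measure (Space N)) t‖ₑ * ‖f (y - t)‖ₑ := by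
        refine lintegral_mono fun y => ?_
        refine (enorm_integral_le_lintegral_enorm _).trans (lintegral_mono fun t => ?_)
        rw [enorm_smul]
    _ = ∫⁻ t, ∫⁻ y in K, ‖η.normed (volume : Measure (Space N)) t‖ₑ * ‖f (y - t)‖ₑ := by
        refine lintegral_lintegral_swap (Measurable.aemeasurable ?_)
        exact (hηm.comp measurable_snd).mul (hfm.comp (measurable_fst.sub measurable_snd))
    _ ≤ ∫⁻ t, ‖η.normed (volume : Measure (Space N)) t‖ₑ * ∫⁻ y in K', ‖f y‖ₑ := by
        refine lintegral_mono fun t => ?_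
        rw [lintegral_const_mul' _ _ enorm_ne_top]
        by_cases ht : ‖t‖ ≤ η.rOut
        · refine mul_le_mul_right ?_ _
          simpa only [sub_eq_add_neg] using setLIntegral_comp_add_le (fun y => ‖f y‖ₑ) hK hK'
            (t := -t) fun y hy => by simpa only [sub_eq_add_neg] using hKK' y hy t ht
        · have : η.normed (volume : Measure (Space N)) t = 0 := by
            rw [← Function.notMem_support, η.support_normed_eq]
            simpa using (not_le.1 ht).le
          simp [this]
    _ = ∫⁻ y in K', ‖f y‖ₑ := by
        rw [lintegral_mul_const _ hηm, lintegral_enorm_normed, one_mul]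

end Mollify

/-- The covariant increment `f(y + k) - f(y) + k · G(y)`. -/
def increment (f : Space N → ℝ) (G : Space N → Space N) (k y : Space N) : ℝ :=
  f (y + k) - f y + inner ℝ k (G y)

/-- The increment is linear in the pair `(f, G)` and commutes with translations. This exact
commutation is the reason for working with first order increments and not with the magnetic
difference, whose phase depends on position. -/
theorem increment_mollify (η : ContDiffBump (0 : Space N)) {f : Space N → ℝ}
    {G : Space N → Space N} (hf : Integrable f) (hG : Integrable G) (k y : Space N) :
    increment (mollify η f) (mollify η G) k y = mollify η (increment f G k) y := by
  have h1 := integrable_mollify_integrand η hf (y + k)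
  have h2 := integrable_mollify_integrand η hf y
  have h3 := integrable_mollify_integrand η hG y
  simp only [increment, mollify]
  have h12 : Integrable fun t => η.normed volume t • f (y + k - t) -
    η.normed volume t • f (y - t) := h1.sub h2
  rw [← integral_inner h3, ← integral_sub h1 h2, ← integral_add h12 (h3.const_inner k)]
  refine integral_congr_ae (Eventually.of_forall fun t => ?_)
  simp only [smul_eq_mul, inner_smul_right, sub_add_eq_add_sub]
  ring

theorem integrable_pairing_prod (η : ContDiffBump (0 : Space N)) {f : Space N → ℝ}
    {G : Space N → Space N} (hf : Integrable f) (hG : Integrable G) {φ : Space N → Space N}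
    (hφ : ContDiff ℝ 1 φ) (hc : HasCompactSupport φ) :
    Integrable (fun p : Space N × Space N => η.normed volume p.2 *
      (f (p.1 - p.2) * divergence φ p.1 - inner ℝ (G (p.1 - p.2)) (φ p.1)))
      (volume.prod volume) := by
  obtain ⟨C, hC⟩ := exists_bound (continuous_divergence hφ) (hasCompactSupport_divergence hc)
  obtain ⟨C', hC'⟩ := exists_bound hφ.continuous hc
  have hη := η.integrable_normed (μ := (volume : Measure (Space N)))
  have h1 := hη.convolution_integrand (ContinuousLinearMap.lsmul ℝ ℝ) hf
  have h2 := hη.convolution_integrand (ContinuousLinearMap.lsmul ℝ ℝ) hG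
  have h3 := h1.mul_bdd (c := C) (g := fun p : Space N × Space N => divergence φ p.1)
    ((continuous_divergence hφ).comp continuous_fst).aestronglyMeasurable
    (Eventually.of_forall fun p => hC p.1)
  have h4 : Integrable (fun p : Space N × Space N => (inner ℝ
      (η.normed volume p.2 • G (p.1 - p.2)) (φ p.1) : ℝ)) (volume.prod volume) := by
    refine (h2.norm.mul_const C').mono' (h2.aestronglyMeasurable.inner
      (hφ.continuous.comp continuous_fst).aestronglyMeasurable)
      (Eventually.of_forall fun p => ?_)
    refine (norm_inner_le_norm _ _).trans ?_
    simp only [ContinuousLinearMap.lsmul_apply]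
    gcongr
    exact hC' p.1
  refine (h3.sub h4).congr (Eventually.of_forall fun p => ?_)
  simp only [Pi.sub_apply, ContinuousLinearMap.lsmul_apply, smul_eq_mul, real_inner_smul_left]
  ring

theorem pairing_mollify (η : ContDiffBump (0 : Space N)) {f : Space N → ℝ}
    {G : Space N → Space N} (hf : Integrable f) (hG : Integrable G) {φ : Space N → Space N}
    (hφ : ContDiff ℝ 1 φ) (hc : HasCompactSupport φ) :
    pairing (mollify η f) (mollify η G) φ =
      ∫ t, η.normed volume t * pairing f G (fun x => φ (x + t)) := by
  calc pairing (mollify η f) (mollify η G) φ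
      = ∫ x, ∫ t, η.normed volume t *
          (f (x - t) * divergence φ x - inner ℝ (G (x - t)) (φ x)) := by
        rw [pairing]
        refine integral_congr_ae (Eventually.of_forall fun x => ?_)
        have h1 := integrable_mollify_integrand η hf x
        have h3 := integrable_mollify_integrand η hG x
        simp only [mollify]
        rw [real_inner_comm, ← integral_inner h3, ← integral_mul_const,
          ← integral_sub (h1.mul_const _) (h3.const_inner _)]
        refine integral_congr_ae (Eventually.of_forall fun t => ?_)
        simp only [smul_eq_mul, inner_smul_right, real_inner_comm (φ x)]
        ring
    _ = ∫ t, ∫ x, η.normed volume t *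
          (f (x - t) * divergence φ x - inner ℝ (G (x - t)) (φ x)) :=
        integral_integral_swap (integrable_pairing_prod η hf hG hφ hc)
    _ = _ := by
        simp only [integral_const_mul, pairing_translate]

/-- Mollifying the pair averages its pairings with the translates of `φ`, each of which is
admissible in `W`. -/
theorem pairing_mollify_le (η : ContDiffBump (0 : Space N)) {f : Space N → ℝ}
    {G : Space N → Space N} (hf : Integrable f) (hG : Integrable G) {W : Set (Space N)}
    (hV : totalVariation f G W ≠ ∞) {φ : Space N → Space N}
    (hφ : ContDiff ℝ 1 φ) (hc : HasCompactSupport φ)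
    (hW : ∀ t, ‖t‖ ≤ η.rOut → IsTestField W fun x => φ (x + t)) :
    pairing (mollify η f) (mollify η G) φ ≤ (totalVariation f G W).toReal := by
  rw [pairing_mollify η hf hG hφ hc]
  have hint : Integrable fun t => η.normed volume t * pairing f G (fun x => φ (x + t)) := by
    have := (integrable_pairing_prod η hf hG hφ hc).integral_prod_right
    simpa only [integral_const_mul, pairing_translate] using this
  calc ∫ t, η.normed volume t * pairing f G (fun x => φ (x + t))
      ≤ ∫ t, η.normed volume t * (totalVariation f G W).toReal := by
        refine integral_mono hint (η.integrable_normed.mul_const _) fun t => ?_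
        by_cases ht : ‖t‖ ≤ η.rOut
        · exact mul_le_mul_of_nonneg_left (pairing_le_totalVariation hV (hW t ht))
            (η.nonneg_normed _)
        · have : η.normed (volume : Measure (Space N)) t = 0 := by
            rw [← Function.notMem_support, η.support_normed_eq]
            simpa using (not_le.1 ht).le
          simp [this]
    _ = _ := by rw [integral_mul_const, η.integral_normed, one_mul]

theorem continuous_pairing_translate {f : Space N → ℝ} {G : Space N → Space N}
    (hf : Integrable f) (hG : Integrable G) {φ : Space N → Space N}
    (hφ : ContDiff ℝ 1 φ) (hc : HasCompactSupport φ) :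
    Continuous fun t => pairing f G (fun x => φ (x + t)) := by
  obtain ⟨C, hC⟩ := exists_bound (continuous_divergence hφ) (hasCompactSupport_divergence hc)
  obtain ⟨C', hC'⟩ := exists_bound hφ.continuous hc
  have hd := continuous_divergence hφ
  have hφc := hφ.continuous
  simp only [pairing, divergence_translate]
  refine continuous_of_dominated (bound := fun x => ‖f x‖ * C + ‖G x‖ * C') (fun t => ?_)
    (fun t => Eventually.of_forall fun x => ?_) ((hf.norm.mul_const C).add (hG.norm.mul_const C'))
    (Eventually.of_forall fun x => ?_)
  · exact (hf.aestronglyMeasurable.mul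
      (hd.comp (continuous_add_const t)).aestronglyMeasurable).sub
      (hG.aestronglyMeasurable.inner (hφc.comp (continuous_add_const t)).aestronglyMeasurable)
  · refine (norm_sub_le _ _).trans (add_le_add ?_ ?_)
    · rw [norm_mul]
      gcongr
      exact hC _
    · refine (norm_inner_le_norm _ _).trans ?_
      gcongr
      exact hC' _
  · fun_prop

theorem tendsto_pairing_mollify {η : ℕ → ContDiffBump (0 : Space N)}
    (hη : Tendsto (fun n => (η n).rOut) atTop (𝓝 0)) {f : Space N → ℝ}
    {G : Space N → Space N} (hf : Integrable f) (hG : Integrable G) {φ : Space N → Space N}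
    (hφ : ContDiff ℝ 1 φ) (hc : HasCompactSupport φ) :
    Tendsto (fun n => pairing (mollify (η n) f) (mollify (η n) G) φ) atTop
      (𝓝 (pairing f G φ)) := by
  -- The pairing of the mollified pair is the value at `0` of a convolution. The reflection
  -- `continuous_neg` compensates the sign in `0 - t`.
  have h := ContDiffBump.convolution_tendsto_right_of_continuous (μ := volume) hη
    ((continuous_pairing_translate hf hG hφ hc).comp continuous_neg) 0
  simpa [convolution_def, pairing_mollify _ hf hG hφ hc] using h

theorem exists_smooth_cutoff {K : Set (Space N)} (hK : IsCompact K) {ε : ℝ} (hε : 0 < ε) :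
    ∃ χ : Space N → ℝ, ContDiff ℝ (⊤ : ℕ∞) χ ∧ (∀ x, 0 ≤ χ x) ∧ (∀ x, χ x ≤ 1) ∧
      (∀ x ∈ K, χ x = 1) ∧ tsupport χ ⊆ Metric.cthickening ε K := by
  obtain ⟨χ, h0, h1, h⟩ := exists_contMDiffMap_zero_one_of_isClosed
    (modelWithCornersSelf ℝ (Space N)) (n := (⊤ : ℕ∞))
    (Metric.isOpen_thickening (δ := ε) (E := K)).isClosed_compl hK.isClosed
    (Set.disjoint_left.2 fun x hx hxK => hx (Metric.self_subset_thickening hε K hxK))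
  refine ⟨χ, χ.contMDiff.contDiff, fun x => (h x).1, fun x => (h x).2, fun x hx => h1 hx,
    closure_minimal (fun x hx => ?_) Metric.isClosed_cthickening⟩
  by_contra hx'
  exact hx (h0 fun hx'' => hx' (Metric.thickening_subset_cthickening _ _ hx''))

/-! ### The mass of the mollified covariant gradient -/

/-- With `p = |P|`, the right side is the inner product of `P` with the regularized direction `P /
√(|P|² + κ²)`; the loss against `|P|` is at most `κ`. -/
theorem sub_le_sq_div_sqrt {p κ : ℝ} (hp : 0 ≤ p) (hκ : 0 < κ) :
    p - κ ≤ p ^ 2 / √(p ^ 2 + κ ^ 2) := by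
  have hs : 0 < √(p ^ 2 + κ ^ 2) := Real.sqrt_pos.2 (by positivity)
  have hs' : √(p ^ 2 + κ ^ 2) ≤ p + κ := Real.sqrt_le_iff.2 ⟨by positivity, by nlinarith⟩
  rw [le_div_iff₀ hs]
  rcases le_total p κ with h | h
  · nlinarith [mul_nonneg (sub_nonneg.2 h) hs.le, sq_nonneg p]
  · nlinarith [mul_le_mul_of_nonneg_left hs' (sub_nonneg.2 h)]

/-- With `P` the covariant gradient, the ideal test field `-P / |P|` is replaced by the smooth `-χ P
/ √(|P|² + κ²)`, and `κ → 0`. The margin `2 * η.rOut` is spent once on the cutoff `χ` and once on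
the translations in the mollification. -/
theorem lintegral_enorm_covGrad_mollify_le (η : ContDiffBump (0 : Space N)) {f : Space N → ℝ}
    {G : Space N → Space N} (hf : Integrable f) (hG : Integrable G) {K W : Set (Space N)}
    (hK : IsCompact K) (hKW : Metric.cthickening (2 * η.rOut) K ⊆ W) :
    ∫⁻ x in K, ‖covGrad (mollify η f) (mollify η G) x‖ₑ ≤ totalVariation f G W := by
  by_cases hV : totalVariation f G W = ∞
  · simp [hV]
  have hε := η.rOut_pos
  have hg := contDiff_mollify η hf
  have hH := contDiff_mollify η hG
  set g := mollify η f
  set H := mollify η G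
  have hP := contDiff_covGrad hg hH
  obtain ⟨χ, hχ, hχ0, hχ1, hχK, hχs⟩ := exists_smooth_cutoff hK hε
  have hcK : IsCompact (Metric.cthickening η.rOut K) := hK.cthickening
  have hχc : HasCompactSupport χ := hcK.of_isClosed_subset (isClosed_tsupport χ) hχs
  have hPc := hP.continuous
  have hχcont := hχ.continuous
  have hχP : Integrable fun x => χ x * ‖covGrad g H x‖ :=
    Continuous.integrable_of_hasCompactSupport (by fun_prop) hχc.mul_right
  have hχi : Integrable χ := hχcont.integrable_of_hasCompactSupport hχc
  have hg1 : ContDiff ℝ 1 g := hg.of_le (by exact_mod_cast le_top)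
  have key : ∀ κ : ℝ, 0 < κ → (∫ x, χ x * ‖covGrad g H x‖) ≤
      (totalVariation f G W).toReal + κ * ∫ x, χ x := by
    intro κ hκ
    have hpos : ∀ x, 0 < ‖covGrad g H x‖ ^ 2 + κ ^ 2 := fun x => by positivity
    have hspos : ∀ x, 0 < √(‖covGrad g H x‖ ^ 2 + κ ^ 2) := fun x => Real.sqrt_pos.2 (hpos x)
    set φ : Space N → Space N := fun x =>
      -((χ x / √(‖covGrad g H x‖ ^ 2 + κ ^ 2)) • covGrad g H x) with hφdef
    have hφ : ContDiff ℝ (⊤ : ℕ∞) φ :=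
      ((hχ.div (((hP.norm_sq ℝ).add contDiff_const).sqrt fun x => (hpos x).ne')
        fun x => (hspos x).ne').smul hP).neg
    have hsupp : tsupport φ ⊆ Metric.cthickening η.rOut K := by
      refine (closure_mono fun x hx => ?_).trans hχs
      contrapose! hx
      rw [Function.notMem_support] at hx ⊢
      simp [hφdef, hx]
    have hφc : HasCompactSupport φ := hcK.of_isClosed_subset (isClosed_tsupport φ) hsupp
    have hφ1 : ContDiff ℝ 1 φ := hφ.of_le (by exact_mod_cast le_top)
    have hbound : ∀ x, ‖φ x‖ ≤ 1 := fun x => by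
      simp only [hφdef]
      rw [norm_neg, norm_smul, Real.norm_of_nonneg (div_nonneg (hχ0 x) (hspos x).le), div_mul_eq_mul_div,
        div_le_one (hspos x)]
      calc χ x * ‖covGrad g H x‖ ≤ ‖covGrad g H x‖ :=
            mul_le_of_le_one_left (norm_nonneg _) (hχ1 x)
        _ ≤ _ := Real.le_sqrt_of_sq_le (by nlinarith [sq_nonneg κ])
    have hle := pairing_mollify_le η hf hG (W := W) hV hφ1 hφc fun t ht => by
      have hts : tsupport (fun x => φ (x + t)) ⊆ (fun x => x + t) ⁻¹' tsupport φ :=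
        closure_minimal (fun x hx => subset_closure hx)
          ((isClosed_tsupport φ).preimage (continuous_add_const t))
      refine ⟨hφ.comp (contDiff_id.add contDiff_const), ?_, fun x hx => hKW ?_,
        fun x => hbound _⟩
      · exact hφc.comp_homeomorph (Homeomorph.addRight t)
      · have := Metric.cthickening_cthickening_subset hε.le hε.le K
          (Metric.mem_cthickening_of_dist_le x (x + t) η.rOut _ (hsupp (hts hx)) (by simpa using ht))
        rwa [two_mul]
    rw [pairing_eq_neg_integral_inner_covGrad hg1 hH.continuous hφ1 hφc, ← integral_neg] at hle
    have hφcont := hφ.continuous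
    have hint : Integrable fun x => -(inner ℝ (covGrad g H x) (φ x) : ℝ) :=
      Continuous.integrable_of_hasCompactSupport (by fun_prop) (hφc.mono fun x hx => by
        contrapose! hx
        rw [Function.notMem_support] at hx ⊢
        simp [hx])
    have hmono : (∫ x, (χ x * ‖covGrad g H x‖ - κ * χ x)) ≤
        ∫ x, -(inner ℝ (covGrad g H x) (φ x) : ℝ) := by
      refine integral_mono (hχP.sub (hχi.const_mul κ)) hint fun x => ?_
      have h := mul_le_mul_of_nonneg_left (sub_le_sq_div_sqrt (norm_nonneg (covGrad g H x)) hκ)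
        (hχ0 x)
      simp only [hφdef, inner_neg_right, neg_neg, real_inner_smul_right,
        real_inner_self_eq_norm_sq]
      calc χ x * ‖covGrad g H x‖ - κ * χ x = χ x * (‖covGrad g H x‖ - κ) := by ring
        _ ≤ _ := h
        _ = _ := by ring
    rw [integral_sub hχP (hχi.const_mul κ), integral_const_mul] at hmono
    linarith
  have hlim : Tendsto (fun κ : ℝ => (totalVariation f G W).toReal + κ * ∫ x, χ x) (𝓝[>] 0)
      (𝓝 (totalVariation f G W).toReal) := by
    have : Tendsto (fun κ : ℝ => (totalVariation f G W).toReal + κ * ∫ x, χ x) (𝓝 0)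
        (𝓝 ((totalVariation f G W).toReal + 0 * ∫ x, χ x)) :=
      Continuous.tendsto (by fun_prop) 0
    simpa using this.mono_left nhdsWithin_le_nhds
  have hfin := ge_of_tendsto hlim (eventually_mem_nhdsWithin.mono fun κ hκ => key κ hκ)
  calc ∫⁻ x in K, ‖covGrad g H x‖ₑ ≤ ∫⁻ x, ‖χ x * ‖covGrad g H x‖‖ₑ := by
        rw [← lintegral_indicator hK.measurableSet]
        refine lintegral_mono fun x => ?_
        by_cases hx : x ∈ K
        · simp [hx, hχK x hx]
        · simp [hx]
    _ = ENNReal.ofReal (∫ x, χ x * ‖covGrad g H x‖) := by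
        rw [← ofReal_integral_norm_eq_lintegral_enorm hχP]
        congr 1
        exact integral_congr_ae (Eventually.of_forall fun x =>
          Real.norm_of_nonneg (mul_nonneg (hχ0 x) (norm_nonneg _)))
    _ ≤ totalVariation f G W := ENNReal.ofReal_le_of_le_toReal hfin

/-! ### Increments as integrals along segments -/

/-- The fundamental theorem of calculus on the segment from `y` to `y + k`. The increment has `H`
frozen at `y` while the covariant gradient has it at `y + s k`; the second term corrects this. -/
theorem increment_eq_intervalIntegral {g : Space N → ℝ} {H : Space N → Space N}
    (hg : ContDiff ℝ 1 g) (hH : Continuous H) (k y : Space N) :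
    increment g H k y = ∫ s in (0 : ℝ)..1, ((inner ℝ k (covGrad g H (y + s • k)) : ℝ) -
      inner ℝ k (H (y + s • k) - H y)) := by
  have hgc := hg.continuous_fderiv one_ne_zero
  have hP := continuous_covGrad hg hH
  have hder : ∀ s : ℝ, HasDerivAt (fun s : ℝ => g (y + s • k) + s * inner ℝ k (H y))
      ((inner ℝ k (covGrad g H (y + s • k)) : ℝ) - inner ℝ k (H (y + s • k) - H y)) s := by
    intro s
    have h1 : HasDerivAt (fun s : ℝ => y + s • k) k s := by
      simpa using ((hasDerivAt_id s).smul_const k).const_add y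
    have h2 := ((hg.differentiable one_ne_zero (y + s • k)).hasFDerivAt).comp_hasDerivAt s h1
    have h3 := h2.add ((hasDerivAt_id s).mul_const (inner ℝ k (H y) : ℝ))
    refine h3.congr_deriv ?_
    rw [real_inner_comm (covGrad g H (y + s • k)) k, inner_covGrad, inner_sub_right,
      real_inner_comm (H (y + s • k)) k, real_inner_comm (H y) k]
    ring
  rw [intervalIntegral.integral_eq_sub_of_hasDerivAt (fun s _ => hder s)
    (Continuous.intervalIntegrable (by fun_prop) _ _)]
  simp [increment]
  ring

theorem lintegral_enorm_increment_le {g : Space N → ℝ} {H : Space N → Space N}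
    (hg : ContDiff ℝ 1 g) (hH : Continuous H) {S K : Set (Space N)} (hS : MeasurableSet S)
    (hK : MeasurableSet K) {k : Space N} (hSK : ∀ y ∈ S, ∀ s ∈ Icc (0 : ℝ) 1, y + s • k ∈ K)
    {c : ℝ≥0∞} (hc : ∀ s ∈ Icc (0 : ℝ) 1, ∫⁻ y, ‖H (y + s • k) - H y‖ₑ ≤ c) :
    ∫⁻ y in S, ‖increment g H k y‖ₑ ≤
      (∫⁻ z in K, ‖(inner ℝ k (covGrad g H z) : ℝ)‖ₑ) + ‖k‖ₑ * c := by
  have hP := continuous_covGrad hg hH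
  calc ∫⁻ y in S, ‖increment g H k y‖ₑ
      ≤ ∫⁻ y in S, ∫⁻ s in Ioc (0 : ℝ) 1, (‖(inner ℝ k (covGrad g H (y + s • k)) : ℝ)‖ₑ +
          ‖k‖ₑ * ‖H (y + s • k) - H y‖ₑ) := by
        refine lintegral_mono fun y => ?_
        rw [increment_eq_intervalIntegral hg hH, intervalIntegral.integral_of_le zero_le_one]
        refine (enorm_integral_le_lintegral_enorm _).trans (lintegral_mono fun s => ?_)
        refine enorm_sub_le.trans (add_le_add le_rfl ?_)
        rw [← ofReal_norm, ← ofReal_norm, ← ofReal_norm, ← ENNReal.ofReal_mul (norm_nonneg _)]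
        exact ENNReal.ofReal_le_ofReal (norm_inner_le_norm _ _)
    _ = ∫⁻ s in Ioc (0 : ℝ) 1, ∫⁻ y in S, (‖(inner ℝ k (covGrad g H (y + s • k)) : ℝ)‖ₑ +
          ‖k‖ₑ * ‖H (y + s • k) - H y‖ₑ) := by
        refine lintegral_lintegral_swap (Measurable.aemeasurable ?_)
        simp only [Function.uncurry_def]
        have hm1 : Measurable fun p : Space N × ℝ =>
            ‖(inner ℝ k (covGrad g H (p.1 + p.2 • k)) : ℝ)‖ₑ :=
          Continuous.measurable (by fun_prop)
        have hm2 : Measurable fun p : Space N × ℝ => ‖H (p.1 + p.2 • k) - H p.1‖ₑ :=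
          Continuous.measurable (by fun_prop)
        exact hm1.add (hm2.const_mul _)
    _ ≤ ∫⁻ s in Ioc (0 : ℝ) 1, ((∫⁻ z in K, ‖(inner ℝ k (covGrad g H z) : ℝ)‖ₑ) + ‖k‖ₑ * c) := by
        refine setLIntegral_mono' measurableSet_Ioc fun s hs => ?_
        have hs' : s ∈ Icc (0 : ℝ) 1 := Ioc_subset_Icc_self hs
        rw [lintegral_add_left (Continuous.measurable (by fun_prop)), lintegral_const_mul' _ _ enorm_ne_top]
        refine add_le_add (setLIntegral_comp_add_le (fun z => ‖(inner ℝ k (covGrad g H z) : ℝ)‖ₑ)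
          hS hK fun y hy => hSK y hy s hs') ?_
        gcongr
        exact (setLIntegral_le_lintegral _ _).trans (hc s hs')
    _ = _ := by simp

/-- Mollification commutes with translations and contracts `L¹`. The error from freezing the
potential is thus bounded uniformly in `η`. -/
theorem lintegral_enorm_translate_mollify_le (η : ContDiffBump (0 : Space N))
    {G : Space N → Space N} (hG : Integrable G) (hGm : StronglyMeasurable G) (k : Space N) :
    ∫⁻ y, ‖mollify η G (y + k) - mollify η G y‖ₑ ≤ ∫⁻ y, ‖G (y + k) - G y‖ₑ := by
  have h : ∀ y, mollify η G (y + k) - mollify η G y = mollify η (fun y => G (y + k) - G y) y := by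
    intro y
    rw [mollify, mollify, mollify, ← integral_sub (integrable_mollify_integrand η hG _)
      (integrable_mollify_integrand η hG _)]
    refine integral_congr_ae (Eventually.of_forall fun t => ?_)
    simp only [smul_sub, sub_add_eq_add_sub]
  simp only [h]
  simpa using lintegral_enorm_mollify_le η (f := fun y => G (y + k) - G y)
    ((hGm.comp_measurable (measurable_add_const k)).sub hGm) MeasurableSet.univ
    MeasurableSet.univ fun _ _ _ _ => mem_univ _

theorem tendsto_lintegral_enorm_translate_sub {F : Type*} [NormedAddCommGroup F]
    {G : Space N → F} (hG : Integrable G) :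
    Tendsto (fun k : Space N => ∫⁻ y, ‖G (y + k) - G y‖ₑ) (𝓝 0) (𝓝 0) := by
  have hmp : ∀ k : Space N, MeasurePreserving (fun y : Space N => y + k) :=
    fun k => measurePreserving_add_right volume k
  have hGp : MemLp G 1 := memLp_one_iff_integrable.2 hG
  let τ : C(Space N, C(Space N, Space N)) :=
    (ContinuousMap.mk (fun p : Space N × Space N => p.2 + p.1) (by fun_prop)).curry
  have h1 : Tendsto (fun k => Lp.compMeasurePreserving (τ k) (hmp k) hGp.toLp) (𝓝 0)
      (𝓝 (Lp.compMeasurePreserving (τ 0) (hmp 0) hGp.toLp)) :=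
    (tendsto_const_nhds (x := hGp.toLp)).compMeasurePreservingLp (τ.continuous.tendsto 0) hmp
      (hmp 0) ENNReal.one_ne_top
  have h2 := (tendsto_iff_edist_tendsto_0.1 h1)
  refine h2.congr fun k => ?_
  rw [Lp.edist_def, eLpNorm_one_eq_lintegral_enorm]
  refine lintegral_congr_ae ?_
  have h3 : ∀ k, Lp.compMeasurePreserving (τ k) (hmp k) hGp.toLp =ᵐ[volume]
      fun y => G (y + k) := fun k =>
    (Lp.coeFn_compMeasurePreserving _ (hmp k)).trans
      ((hmp k).quasiMeasurePreserving.ae_eq_comp hGp.coeFn_toLp)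
  filter_upwards [h3 k, h3 0] with y hy hy'
  simp [hy, hy']

/-! ### Estimates for integrable pairs by removing the mollification -/

/-- A sequence of bump functions with supports shrinking to the origin. -/
def bumpSeq (N : ℕ) (n : ℕ) : ContDiffBump (0 : Space N) where
  rIn := 1 / (2 * (n + 1))
  rOut := 1 / (n + 1)
  rIn_pos := by positivity
  rIn_lt_rOut := by
    rw [one_div_lt_one_div (by positivity) (by positivity)]
    have : (0 : ℝ) ≤ n := n.cast_nonneg
    linarith

theorem tendsto_bumpSeq_rOut : Tendsto (fun n => (bumpSeq N n).rOut) atTop (𝓝 0) :=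
  tendsto_one_div_add_atTop_nhds_zero_nat

theorem ae_tendsto_mollify {F : Type*} [NormedAddCommGroup F] [NormedSpace ℝ F] [CompleteSpace F]
    {f : Space N → F} (hf : Integrable f) :
    ∀ᵐ x, Tendsto (fun n => mollify (bumpSeq N n) f x) atTop (𝓝 (f x)) :=
  -- `K := 2` is the ratio `rOut / rIn` of `bumpSeq`; its boundedness is what Lebesgue
  -- differentiation needs.
  ContDiffBump.ae_convolution_tendsto_right_of_locallyIntegrable (μ := volume) (K := 2)
    tendsto_bumpSeq_rOut
    (Eventually.of_forall fun n => by
      simp only [bumpSeq]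
      have : (n : ℝ) + 1 ≠ 0 := by positivity
      field_simp
      rfl) hf.locallyIntegrable

theorem measurable_increment {f : Space N → ℝ} {G : Space N → Space N} (hf : Measurable f)
    (hG : Measurable G) :
    Measurable fun p : Space N × Space N => increment f G p.1 p.2 := by
  unfold increment
  fun_prop

/-- Fatou, as the mollified increments converge almost everywhere. Upper bounds for smooth pairs
pass to `(f, G)` this way. -/
theorem lintegral_enorm_increment_le_liminf {f : Space N → ℝ} {G : Space N → Space N}
    (hf : Integrable f) (hG : Integrable G) (S : Set (Space N)) (k : Space N) :
    ∫⁻ y in S, ‖increment f G k y‖ₑ ≤ liminf (fun n => ∫⁻ y in S,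
      ‖increment (mollify (bumpSeq N n) f) (mollify (bumpSeq N n) G) k y‖ₑ) atTop := by
  have hconv : ∀ᵐ y, Tendsto (fun n =>
      ‖increment (mollify (bumpSeq N n) f) (mollify (bumpSeq N n) G) k y‖ₑ) atTop
      (𝓝 ‖increment f G k y‖ₑ) := by
    have h1 := ae_tendsto_mollify hf
    have h2 := (measurePreserving_add_right volume k).quasiMeasurePreserving.ae h1
    filter_upwards [h1, h2, ae_tendsto_mollify hG] with y hy hy' hy''
    exact ((hy'.sub hy).add (tendsto_const_nhds.inner hy'')).enorm
  calc ∫⁻ y in S, ‖increment f G k y‖ₑ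
      = ∫⁻ y in S, liminf (fun n =>
          ‖increment (mollify (bumpSeq N n) f) (mollify (bumpSeq N n) G) k y‖ₑ) atTop :=
        lintegral_congr_ae (ae_restrict_of_ae (hconv.mono fun y hy => hy.liminf_eq.symm))
    _ ≤ _ := by
        refine lintegral_liminf_le fun n => ?_
        have h := measurable_increment (contDiff_mollify (bumpSeq N n) hf).continuous.measurable
          (contDiff_mollify (bumpSeq N n) hG).continuous.measurable
        exact (h.comp (measurable_const.prodMk measurable_id)).enorm

theorem eventually_cthickening_bumpSeq_subset {K W : Set (Space N)} (hK : IsCompact K)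
    (hW : IsOpen W) (hKW : K ⊆ W) :
    ∀ᶠ n in atTop, Metric.cthickening (2 * (bumpSeq N n).rOut) K ⊆ W := by
  obtain ⟨δ, hδ, hδW⟩ := hK.exists_cthickening_subset_open hW hKW
  have h : Tendsto (fun n => 2 * (bumpSeq N n).rOut) atTop (𝓝 (2 * 0)) :=
    tendsto_bumpSeq_rOut.const_mul 2
  rw [mul_zero] at h
  filter_upwards [h.eventually (gt_mem_nhds hδ)] with n hn
  exact (Metric.cthickening_mono hn.le _).trans hδW

theorem liminf_le_of_eventually_le {a : ℕ → ℝ≥0∞} {b : ℝ≥0∞} (h : ∀ᶠ n in atTop, a n ≤ b) :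
    liminf a atTop ≤ b :=
  (liminf_le_liminf h).trans (by simp)

/-- Translating by `k` inside `W` costs at most `‖k‖` times the total variation. -/
theorem lintegral_enorm_sub_le_of_isCompact {f : Space N → ℝ} (hf : Integrable f)
    {S W : Set (Space N)} (hS : IsCompact S) (hW : IsOpen W) {k : Space N}
    (hSW : ∀ y ∈ S, ∀ s ∈ Icc (0 : ℝ) 1, y + s • k ∈ W) :
    ∫⁻ y in S, ‖f (y + k) - f y‖ₑ ≤ ‖k‖ₑ * totalVariation f 0 W := by
  set K : Set (Space N) := (fun p : Space N × ℝ => p.1 + p.2 • k) '' (S ×ˢ Icc (0 : ℝ) 1)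
  have hK : IsCompact K := (hS.prod isCompact_Icc).image (by fun_prop)
  have hKW : K ⊆ W := by
    rintro _ ⟨p, hp, rfl⟩
    exact hSW _ hp.1 _ hp.2
  have h0 : Integrable (0 : Space N → Space N) := integrable_zero _ _ _
  have h1 := lintegral_enorm_increment_le_liminf hf h0 S k
  simp only [increment, Pi.zero_apply, inner_zero_right, add_zero] at h1
  refine h1.trans (liminf_le_of_eventually_le ?_)
  filter_upwards [eventually_cthickening_bumpSeq_subset hK hW hKW] with n hn
  -- The zero potential stays zero under mollification, hence `c := 0`.
  refine (lintegral_enorm_increment_le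
    ((contDiff_mollify (bumpSeq N n) hf).of_le (by exact_mod_cast le_top))
    (contDiff_mollify (bumpSeq N n) h0).continuous hS.measurableSet hK.measurableSet
    (fun y hy s hs => ⟨(y, s), ⟨hy, hs⟩, rfl⟩) (c := 0) fun s _ => by simp [mollify]).trans ?_
  rw [mul_zero, add_zero]
  calc ∫⁻ z in K, ‖(inner ℝ k (covGrad (mollify (bumpSeq N n) f)
        (mollify (bumpSeq N n) 0) z) : ℝ)‖ₑ
      ≤ ∫⁻ z in K, ‖k‖ₑ * ‖covGrad (mollify (bumpSeq N n) f) (mollify (bumpSeq N n) 0) z‖ₑ := by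
        refine lintegral_mono fun z => ?_
        rw [← ofReal_norm, ← ofReal_norm, ← ofReal_norm, ← ENNReal.ofReal_mul (norm_nonneg _)]
        exact ENNReal.ofReal_le_ofReal (norm_inner_le_norm _ _)
    _ ≤ _ := by
        rw [lintegral_const_mul' _ _ enorm_ne_top]
        gcongr
        exact lintegral_enorm_covGrad_mollify_le _ hf h0 hK hn

/-- Inner regularity of the finite measure with density `F`. -/
theorem setLIntegral_le_of_forall_isCompact {F : Space N → ℝ≥0∞}
    (hF : ∫⁻ y, F y ≠ ∞) {S : Set (Space N)} (hS : MeasurableSet S) {b : ℝ≥0∞}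
    (h : ∀ K ⊆ S, IsCompact K → ∫⁻ y in K, F y ≤ b) : ∫⁻ y in S, F y ≤ b := by
  have := isFiniteMeasure_withDensity hF
  rw [← withDensity_apply F hS, hS.measure_eq_iSup_isCompact_of_ne_top (measure_ne_top _ _)]
  refine iSup₂_le fun K hK => iSup_le fun hKc => ?_
  rw [withDensity_apply F hKc.measurableSet]
  exact h K hK hKc

theorem lintegral_enorm_sub_le {f : Space N → ℝ} (hf : Integrable f)
    {S W : Set (Space N)} (hS : MeasurableSet S) (hW : IsOpen W) {k : Space N}
    (hSW : ∀ y ∈ S, ∀ s ∈ Icc (0 : ℝ) 1, y + s • k ∈ W) :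
    ∫⁻ y in S, ‖f (y + k) - f y‖ₑ ≤ ‖k‖ₑ * totalVariation f 0 W := by
  refine setLIntegral_le_of_forall_isCompact
    ((hf.comp_add_right k).sub hf).hasFiniteIntegral.ne hS fun K hKS hK => ?_
  exact lintegral_enorm_sub_le_of_isCompact hf hK hW fun y hy => hSW y (hKS hy)

/-- The spherical average of the covariant increments over an interior compact set. -/
theorem lintegral_sphere_increment_le (hN : 1 ≤ N) {ω : Space N} (hω : ‖ω‖ = 1)
    {f : Space N → ℝ} {G : Space N → Space N} (hf : Integrable f) (hG : Integrable G)
    (hGm : StronglyMeasurable G) {S W : Set (Space N)} (hS : IsCompact S) (hW : IsOpen W)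
    {r : ℝ} (hr : 0 ≤ r) (hSW : Metric.cthickening r S ⊆ W) {c : ℝ≥0∞}
    (hc : ∀ k : Space N, ‖k‖ ≤ r → ∫⁻ y, ‖G (y + k) - G y‖ₑ ≤ c) :
    ∫⁻ h : Metric.sphere (0 : Space N) 1,
        (∫⁻ y in S, ‖increment f G (r • (h : Space N)) y‖ₑ) ∂(sphereMeasure N) ≤
      ENNReal.ofReal r * (ENNReal.ofReal (sphereConst ω) * totalVariation f G W +
        sphereMeasure N univ * c) := by
  have hK : IsCompact (Metric.cthickening r S) := hS.cthickening
  refine (lintegral_mono fun h => lintegral_enorm_increment_le_liminf hf hG S _).trans ?_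
  refine (lintegral_liminf_le fun n => ?_).trans (liminf_le_of_eventually_le ?_)
  · have h := measurable_increment (contDiff_mollify (bumpSeq N n) hf).continuous.measurable
      (contDiff_mollify (bumpSeq N n) hG).continuous.measurable
    refine Measurable.lintegral_prod_right' (f := fun p : Metric.sphere (0 : Space N) 1 × Space N =>
      ‖increment (mollify (bumpSeq N n) f) (mollify (bumpSeq N n) G) (r • (p.1 : Space N)) p.2‖ₑ) ?_
    exact (h.comp (f := fun p : Metric.sphere (0 : Space N) 1 × Space N =>
      (r • (p.1 : Space N), p.2)) (by fun_prop)).enorm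
  filter_upwards [eventually_cthickening_bumpSeq_subset hK hW hSW] with n hn
  have hg1 : ContDiff ℝ 1 (mollify (bumpSeq N n) f) :=
    (contDiff_mollify (bumpSeq N n) hf).of_le (by exact_mod_cast le_top)
  have hH := (contDiff_mollify (bumpSeq N n) hG).continuous
  have hP := continuous_covGrad hg1 hH
  have hB := lintegral_enorm_covGrad_mollify_le (bumpSeq N n) hf hG hK hn
  set g := mollify (bumpSeq N n) f
  set H := mollify (bumpSeq N n) G
  have hnorm : ∀ h : Metric.sphere (0 : Space N) 1, ‖r • (h : Space N)‖ = r := fun h => by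
    simp [norm_smul, abs_of_nonneg hr]
  have hen : ∀ h : Metric.sphere (0 : Space N) 1, ‖r • (h : Space N)‖ₑ = ENNReal.ofReal r :=
    fun h => by rw [← ofReal_norm, hnorm]
  have hsk : ∀ h : Metric.sphere (0 : Space N) 1, ∀ s ∈ Icc (0 : ℝ) 1,
      ‖s • r • (h : Space N)‖ ≤ r := fun h s hs => by
    rw [norm_smul, hnorm, Real.norm_of_nonneg hs.1]
    exact mul_le_of_le_one_left hr hs.2
  calc ∫⁻ h : Metric.sphere (0 : Space N) 1,
        (∫⁻ y in S, ‖increment g H (r • (h : Space N)) y‖ₑ) ∂(sphereMeasure N)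
      ≤ ∫⁻ h : Metric.sphere (0 : Space N) 1, (ENNReal.ofReal r * (∫⁻ z in Metric.cthickening r S,
          ‖(inner ℝ (h : Space N) (covGrad g H z) : ℝ)‖ₑ) + ENNReal.ofReal r * c)
          ∂(sphereMeasure N) := by
        refine lintegral_mono fun h => ?_
        refine (lintegral_enorm_increment_le hg1 hH hS.measurableSet hK.measurableSet
          (fun y hy s hs => Metric.mem_cthickening_of_dist_le _ y r S hy (by
            simpa using hsk h s hs)) (c := c) fun s hs =>
          (lintegral_enorm_translate_mollify_le _ hG hGm _).trans (hc _ (hsk h s hs))).trans_eq ?_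
        rw [hen, ← lintegral_const_mul' _ _ ENNReal.ofReal_ne_top]
        congr 1
        refine lintegral_congr fun z => ?_
        rw [real_inner_smul_left, enorm_mul, Real.enorm_of_nonneg hr]
    _ = ENNReal.ofReal r * ((∫⁻ z in Metric.cthickening r S,
          ∫⁻ h : Metric.sphere (0 : Space N) 1, ‖(inner ℝ (h : Space N) (covGrad g H z) : ℝ)‖ₑ
            ∂(sphereMeasure N)) + sphereMeasure N univ * c) := by
        rw [lintegral_add_right _ measurable_const, lintegral_const_mul' _ _ ENNReal.ofReal_ne_top,
          lintegral_const, lintegral_lintegral_swap, mul_add, mul_assoc, mul_comm c]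
        refine (Continuous.measurable ?_).aemeasurable
        simp only [Function.uncurry_def]
        fun_prop
    _ ≤ _ := by
        -- The spherical integral of `|h · P(z)|` is `Q |P(z)|`; the mass of `P` over the thickened
        -- set is bounded by the total variation through `hB`.
        simp only [lintegral_sphere_enorm_inner hN hω]
        rw [lintegral_const_mul' _ _ ENNReal.ofReal_ne_top]
        gcongr

/-! ### Smallness in thin boundary layers -/

/-- The part of `Ω` at distance less than `δ` from the complement. -/
def boundaryLayer (Ω : Set (Space N)) (δ : ℝ) : Set (Space N) := Ω ∩ Metric.thickening δ Ωᶜ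

theorem isOpen_boundaryLayer {Ω : Set (Space N)} (hΩ : IsOpen Ω) (δ : ℝ) :
    IsOpen (boundaryLayer Ω δ) := hΩ.inter Metric.isOpen_thickening

/-- A compactly supported `φ` attains the total variation up to `κ` and lives away from a thin
layer. Any field `ψ` supported in the layer can be added to it, so its pairing is at most `κ`. -/
theorem exists_totalVariation_boundaryLayer_le {f : Space N → ℝ} {G : Space N → Space N}
    (hf : Integrable f) (hG : Integrable G) {Ω : Set (Space N)} (hΩ : IsOpen Ω)
    (hV : totalVariation f G Ω ≠ ∞) {κ : ℝ≥0∞} (hκ : κ ≠ 0) :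
    ∃ δ > 0, totalVariation f G (boundaryLayer Ω δ) ≤ κ := by
  rcases eq_or_ne (totalVariation f G Ω) 0 with h0 | h0
  · refine ⟨1, one_pos, ?_⟩
    refine ((totalVariation_mono f G inter_subset_left).trans h0.le).trans zero_le
  obtain ⟨φ, hφ⟩ := lt_iSup_iff.1 (ENNReal.sub_lt_self hV h0 hκ)
  obtain ⟨hφΩ, hφκ⟩ := lt_iSup_iff.1 hφ
  obtain ⟨δ, hδ, hδΩ⟩ := hφΩ.compact.exists_cthickening_subset_open hΩ hφΩ.support
  have hdisj : ∀ x ∈ tsupport φ, x ∉ boundaryLayer Ω δ := by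
    rintro x hx ⟨_, hx'⟩
    obtain ⟨w, hw, hxw⟩ := Metric.mem_thickening_iff.1 hx'
    exact hw (hδΩ (Metric.mem_cthickening_of_dist_le w x δ _ hx (by rw [dist_comm]; exact hxw.le)))
  refine ⟨δ, hδ, iSup₂_le fun ψ hψ => ?_⟩
  -- The supports are disjoint, so the sum still has norm at most one.
  have hsum : IsTestField Ω fun x => φ x + ψ x := by
    refine ⟨hφΩ.smooth.add hψ.smooth, hφΩ.compact.add hψ.compact, ?_, fun x => ?_⟩
    · exact (tsupport_add φ ψ).trans
        (union_subset hφΩ.support (hψ.support.trans inter_subset_left))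
    · by_cases hx : x ∈ tsupport φ
      · have : ψ x = 0 := image_eq_zero_of_notMem_tsupport fun h => hdisj x hx (hψ.support h)
        simpa [this] using hφΩ.bound x
      · simpa [image_eq_zero_of_notMem_tsupport hx] using hψ.bound x
  have hle : ENNReal.ofReal (pairing f G fun x => φ x + ψ x) ≤ totalVariation f G Ω :=
    le_iSup₂_of_le _ hsum le_rfl
  rw [pairing_add hf hG hφΩ.contDiff_one hφΩ.compact hψ.contDiff_one hψ.compact] at hle
  rcases le_total (pairing f G ψ) 0 with hψ0 | hψ0
  · simp [ENNReal.ofReal_of_nonpos hψ0]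
  have hφ0 : 0 ≤ pairing f G φ := (ENNReal.ofReal_pos.1 (zero_le.trans_lt hφκ)).le
  rw [ENNReal.ofReal_add hφ0 hψ0] at hle
  have h2 : totalVariation f G Ω ≤ ENNReal.ofReal (pairing f G φ) + κ :=
    tsub_le_iff_right.1 hφκ.le
  exact (ENNReal.add_le_add_iff_left ENNReal.ofReal_ne_top).1 (hle.trans h2)

theorem tendsto_lintegral_boundaryLayer {F : Space N → ℝ≥0∞} (hFm : Measurable F)
    (hF : ∫⁻ y, F y ≠ ∞) {Ω : Set (Space N)} (hΩ : IsOpen Ω) :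
    Tendsto (fun δ => ∫⁻ y in boundaryLayer Ω δ, F y) (𝓝[>] 0) (𝓝 0) := by
  have h : Tendsto (fun δ => ∫⁻ y, (boundaryLayer Ω δ).indicator F y) (𝓝[>] 0)
      (𝓝 (∫⁻ _ : Space N, 0)) := by
    refine tendsto_lintegral_filter_of_dominated_convergence F
      (Eventually.of_forall fun δ => hFm.indicator (isOpen_boundaryLayer hΩ δ).measurableSet)
      (Eventually.of_forall fun δ => Eventually.of_forall fun y => indicator_le_self _ _ _) hF
      (Eventually.of_forall fun y => ?_)
    refine tendsto_const_nhds.congr' ?_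
    by_cases hy : y ∈ Ω
    · obtain ⟨ε, hε, hεΩ⟩ := Metric.isOpen_iff.1 hΩ y hy
      filter_upwards [Ioo_mem_nhdsGT hε] with δ hδ
      rw [indicator_of_notMem]
      rintro ⟨_, hy'⟩
      obtain ⟨w, hw, hyw⟩ := Metric.mem_thickening_iff.1 hy'
      exact hw (hεΩ (by rw [Metric.mem_ball, dist_comm]; exact hyw.trans hδ.2))
    · exact Eventually.of_forall fun δ => (indicator_of_notMem (fun h => hy h.1) _).symm
  simpa [lintegral_indicator (isOpen_boundaryLayer hΩ _).measurableSet] using h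

/-! ### Translations near a Lipschitz boundary -/

theorem norm_sub_inner_smul_le {ν : Space N} (hν : ‖ν‖ = 1) (v : Space N) :
    ‖v - (inner ℝ ν v : ℝ) • ν‖ ≤ ‖v‖ := by
  refine (sq_le_sq₀ (norm_nonneg _) (norm_nonneg _)).1 ?_
  rw [norm_sub_sq_real, real_inner_smul_right, norm_smul, hν, real_inner_comm ν v]
  simp only [mul_one, Real.norm_eq_abs, sq_abs]
  nlinarith [sq_nonneg (inner ℝ ν v : ℝ)]

/-- Points above the graph of a Lipschitz function stay above it when moved inside the cone
around the direction `ν`. -/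
theorem graph_lt_of_cone {ν : Space N} (hν : ‖ν‖ = 1) {γ : Space N → ℝ} {K : ℝ≥0}
    (hγ : LipschitzWith K γ) {y v : Space N} {t : ℝ} (ht : (K + 1) * ‖v‖ ≤ t)
    (hy : γ (y - (inner ℝ ν y : ℝ) • ν) < inner ℝ ν y) :
    γ ((y + v + t • ν) - (inner ℝ ν (y + v + t • ν) : ℝ) • ν) < inner ℝ ν (y + v + t • ν) := by
  have hνν : (inner ℝ ν ν : ℝ) = 1 := by rw [real_inner_self_eq_norm_sq, hν, one_pow]
  -- The projection to `ν^⊥` moves by at most `‖v‖`, so `γ` grows by at most `K ‖v‖`, while the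
  -- height grows by at least `t - ‖v‖ ≥ K ‖v‖`.
  have h1 : (y + v + t • ν) - (inner ℝ ν (y + v + t • ν) : ℝ) • ν =
      (y - (inner ℝ ν y : ℝ) • ν) + (v - (inner ℝ ν v : ℝ) • ν) := by
    simp only [inner_add_right, real_inner_smul_right, hνν, mul_one, add_smul]
    abel
  have h2 := hγ.dist_le_mul ((y - (inner ℝ ν y : ℝ) • ν) + (v - (inner ℝ ν v : ℝ) • ν))
    (y - (inner ℝ ν y : ℝ) • ν)
  rw [dist_self_add_left, Real.dist_eq] at h2
  have h3 := mul_le_mul_of_nonneg_left (norm_sub_inner_smul_le hν v) K.2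
  have h4 := (abs_le.1 (abs_real_inner_le_norm ν v)).1
  rw [hν, one_mul] at h4
  rw [h1]
  simp only [inner_add_right, real_inner_smul_right, hνν, mul_one]
  have h5 := (abs_le.1 h2).2
  simp only [NNReal.val_eq_coe] at h3
  linarith

/-- The points of the boundary layer that stay in `Ω` after the translation by `k`. -/
def shiftLayer (Ω : Set (Space N)) (δ : ℝ) (k : Space N) : Set (Space N) :=
  boundaryLayer Ω δ ∩ {y | y + k ∈ Ω}

theorem isOpen_shiftLayer {Ω : Set (Space N)} (hΩ : IsOpen Ω) (δ : ℝ) (k : Space N) :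
    IsOpen (shiftLayer Ω δ k) :=
  (isOpen_boundaryLayer hΩ δ).inter (hΩ.preimage (continuous_add_const k))

/-- Translations near `U` are controlled by the variation in the boundary layer. -/
def ShiftBound (Ω U : Set (Space N)) : Prop :=
  ∃ M : ℝ≥0, ∀ δ > 0, ∃ r₀ > 0, ∀ k : Space N, ‖k‖ ≤ r₀ → ∀ f : Space N → ℝ, Integrable f →
    Measurable f → ∫⁻ y in U ∩ shiftLayer Ω δ k, ‖f (y + k) - f y‖ₑ ≤
      M * ‖k‖ₑ * totalVariation f 0 (boundaryLayer Ω (2 * δ))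

theorem ShiftBound.mono {Ω U U' : Set (Space N)} (h : ShiftBound Ω U') (hU : U ⊆ U') :
    ShiftBound Ω U := by
  obtain ⟨M, hM⟩ := h
  refine ⟨M, fun δ hδ => ?_⟩
  obtain ⟨r, hr, h⟩ := hM δ hδ
  exact ⟨r, hr, fun k hk f hf hfm =>
    (lintegral_mono_set (inter_subset_inter_left _ hU)).trans (h k hk f hf hfm)⟩

theorem ShiftBound.union {Ω U U' : Set (Space N)} (h : ShiftBound Ω U) (h' : ShiftBound Ω U') :
    ShiftBound Ω (U ∪ U') := by
  obtain ⟨M, hM⟩ := h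
  obtain ⟨M', hM'⟩ := h'
  refine ⟨M + M', fun δ hδ => ?_⟩
  obtain ⟨r, hr, h⟩ := hM δ hδ
  obtain ⟨r', hr', h'⟩ := hM' δ hδ
  refine ⟨min r r', lt_min hr hr', fun k hk f hf hfm => ?_⟩
  rw [union_inter_distrib_right]
  refine (lintegral_union_le _ _ _).trans ?_
  refine (add_le_add (h k (hk.trans (min_le_left _ _)) f hf hfm)
    (h' k (hk.trans (min_le_right _ _)) f hf hfm)).trans_eq ?_
  rw [ENNReal.coe_add, add_mul, add_mul]

/-- The segment from `y` to `y + k` may leave `Ω`. With `c = (K + 1) ‖k‖ ν` pointing into `Ω`, the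
detour `y`, `y + c`, `y + c + k`, `y + k` stays above the graph. Its length is `(2 (K + 1) + 1)
‖k‖`, which gives a constant independent of `δ`. -/
theorem exists_shiftBound_ball {Ω : Set (Space N)} (hΩ : IsOpen Ω)
    (hL : HasLipschitzBoundary Ω) {p : Space N} (hp : p ∈ frontier Ω) :
    ∃ ρ > 0, ShiftBound Ω (Metric.ball p ρ) := by
  obtain ⟨ν, γ, K, r, hν, hγ, hr, hΩr⟩ := hL p hp
  refine ⟨r / 2, half_pos hr, 2 * (K + 1) + 1, fun δ hδ => ?_⟩
  have hK1 : (0 : ℝ) < K + 2 := by positivity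
  -- The detour stays within `(K + 2) ‖k‖` of `y`. Keeping this below `r / 2` stays in the chart,
  -- and keeping it below `δ` stays in the layer of width `2 δ`.
  refine ⟨min (r / 2) δ / (K + 2), div_pos (lt_min (half_pos hr) hδ) hK1, fun k hk f hf hfm => ?_⟩
  have hk' : (K + 2) * ‖k‖ ≤ min (r / 2) δ := by rwa [le_div_iff₀' hK1] at hk
  set c : Space N := ((K + 1) * ‖k‖) • ν with hc
  have hKk : 0 ≤ (K + 1) * ‖k‖ := by positivity
  have hcn : ‖c‖ = (K + 1) * ‖k‖ := by
    rw [hc, norm_smul, hν, mul_one, Real.norm_of_nonneg hKk]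
  set S := Metric.ball p (r / 2) ∩ shiftLayer Ω δ k with hS
  set W := boundaryLayer Ω (2 * δ) with hW
  have hSo : IsOpen S := Metric.isOpen_ball.inter (isOpen_shiftLayer hΩ δ k)
  have hWo : IsOpen W := isOpen_boundaryLayer hΩ _
  have hmem : ∀ y ∈ S, ∀ z, ‖z - y‖ ≤ (K + 2) * ‖k‖ →
      γ (z - (inner ℝ ν z : ℝ) • ν) < inner ℝ ν z → z ∈ W := by
    rintro y ⟨hyp, ⟨hyΩ, hyt⟩, -⟩ z hz hzγ
    obtain ⟨w, hw, hyw⟩ := Metric.mem_thickening_iff.1 hyt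
    have hzy : dist z y ≤ min (r / 2) δ := by rw [dist_eq_norm]; exact hz.trans hk'
    refine ⟨(hΩr z ?_).2 hzγ, Metric.mem_thickening_iff.2 ⟨w, hw, ?_⟩⟩
    · have := dist_triangle z y p
      have := min_le_left (r / 2) δ
      rw [Metric.mem_ball] at hyp ⊢
      linarith
    · have := dist_triangle z y w
      have := min_le_right (r / 2) δ
      linarith
  have hyγ : ∀ y ∈ S, γ (y - (inner ℝ ν y : ℝ) • ν) < inner ℝ ν y := fun y hy =>
    (hΩr y (Metric.ball_subset_ball (half_le_self hr.le) hy.1)).1 hy.2.1.1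
  have hykγ : ∀ y ∈ S, γ (y + k - (inner ℝ ν (y + k) : ℝ) • ν) < inner ℝ ν (y + k) := by
    intro y hy
    refine (hΩr (y + k) ?_).1 hy.2.2
    have h1 : dist (y + k) y = ‖k‖ := by simp
    have h2 := dist_triangle (y + k) y p
    have h3 := min_le_left (r / 2) δ
    have h4 : ‖k‖ ≤ (K + 2) * ‖k‖ := le_mul_of_one_le_left (norm_nonneg _) (by linarith [K.2, K.coe_nonneg])
    have h5 := hy.1
    rw [Metric.mem_ball] at h5 ⊢
    linarith
  have hsc : ∀ s ∈ Icc (0 : ℝ) 1, ‖s • c‖ ≤ (K + 1) * ‖k‖ := fun s hs => by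
    rw [norm_smul, hcn, Real.norm_of_nonneg hs.1]
    exact mul_le_of_le_one_left hKk hs.2
  have hsk : ∀ s ∈ Icc (0 : ℝ) 1, ‖s • k‖ ≤ ‖k‖ := fun s hs => by
    rw [norm_smul, Real.norm_of_nonneg hs.1]
    exact mul_le_of_le_one_left (norm_nonneg _) hs.2
  have hb1 : ∫⁻ y in S, ‖f (y + c) - f y‖ₑ ≤ ‖c‖ₑ * totalVariation f 0 W := by
    refine lintegral_enorm_sub_le hf hSo.measurableSet hWo fun y hy s hs => hmem y hy _ ?_ ?_
    · rw [add_sub_cancel_left]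
      exact (hsc s hs).trans (by linarith [norm_nonneg k])
    · have := graph_lt_of_cone hν hγ (y := y) (v := 0) (t := s * ((K + 1) * ‖k‖))
        (by rw [norm_zero, mul_zero]; exact mul_nonneg hs.1 hKk) (hyγ y hy)
      simpa only [add_zero, hc, smul_smul] using this
  have hb2 : ∫⁻ y in S, ‖f (y + k + c) - f (y + k)‖ₑ ≤ ‖c‖ₑ * totalVariation f 0 W := by
    have hS'o : IsOpen ((fun y => y - k) ⁻¹' S) := hSo.preimage (continuous_sub_right k)
    refine (setLIntegral_comp_add_le (fun y => ‖f (y + c) - f y‖ₑ) hSo.measurableSet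
      hS'o.measurableSet (t := k) fun y hy => by simpa using hy).trans ?_
    refine lintegral_enorm_sub_le hf hS'o.measurableSet hWo fun z hz s hs =>
      hmem (z - k) hz _ ?_ ?_
    · have : z + s • c - (z - k) = s • c + k := by abel
      rw [this]
      refine (norm_add_le _ _).trans ?_
      linarith [hsc s hs]
    · have := graph_lt_of_cone hν hγ (y := z) (v := 0) (t := s * ((K + 1) * ‖k‖))
        (by rw [norm_zero, mul_zero]; exact mul_nonneg hs.1 hKk)
        (by simpa using hykγ (z - k) hz)
      simpa only [add_zero, hc, smul_smul] using this
  -- The middle leg needs the cone condition: `c` lifts by `(K + 1) ‖k‖`, enough for every sideways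
  -- move `s k`.
  have hb3 : ∫⁻ y in S, ‖f (y + c + k) - f (y + c)‖ₑ ≤ ‖k‖ₑ * totalVariation f 0 W := by
    have hS'o : IsOpen ((fun y => y - c) ⁻¹' S) := hSo.preimage (continuous_sub_right c)
    refine (setLIntegral_comp_add_le (fun y => ‖f (y + k) - f y‖ₑ) hSo.measurableSet
      hS'o.measurableSet (t := c) fun y hy => by simpa using hy).trans ?_
    refine lintegral_enorm_sub_le hf hS'o.measurableSet hWo fun z hz s hs =>
      hmem (z - c) hz _ ?_ ?_
    · have : z + s • k - (z - c) = c + s • k := by abel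
      rw [this]
      refine (norm_add_le _ _).trans ?_
      linarith [hsk s hs]
    · have := graph_lt_of_cone hν hγ (y := z - c) (v := s • k) (t := (K + 1) * ‖k‖)
        (mul_le_mul_of_nonneg_left (hsk s hs) (by positivity)) (hyγ (z - c) hz)
      rwa [← hc, show z - c + s • k + c = z + s • k by abel] at this
  calc ∫⁻ y in S, ‖f (y + k) - f y‖ₑ
      ≤ ∫⁻ y in S, (‖f (y + k + c) - f (y + k)‖ₑ +
          (‖f (y + c + k) - f (y + c)‖ₑ + ‖f (y + c) - f y‖ₑ)) := by
        refine lintegral_mono fun y => ?_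
        have : f (y + k) - f y = -(f (y + k + c) - f (y + k)) +
            ((f (y + c + k) - f (y + c)) + (f (y + c) - f y)) := by
          rw [add_right_comm y c k]; ring
        rw [this]
        refine (enorm_add_le _ _).trans ?_
        rw [enorm_neg]
        gcongr
        exact enorm_add_le _ _
    _ ≤ ‖c‖ₑ * totalVariation f 0 W + (‖k‖ₑ * totalVariation f 0 W +
          ‖c‖ₑ * totalVariation f 0 W) := by
        rw [lintegral_add_left (by fun_prop), lintegral_add_left (by fun_prop)]
        exact add_le_add hb2 (add_le_add hb3 hb1)
    _ = _ := by
        have hce : ‖c‖ₑ = ((K + 1 : ℝ≥0) : ℝ≥0∞) * ‖k‖ₑ := by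
          rw [← ofReal_norm, hcn, ENNReal.ofReal_mul (by positivity), ofReal_norm]
          congr 1
          rw [← ENNReal.ofReal_coe_nnreal]
          simp
        rw [hce]
        push_cast
        ring

theorem exists_shiftBound_frontier {Ω : Set (Space N)} (hΩ : IsOpen Ω)
    (hb : Bornology.IsBounded Ω) (hL : HasLipschitzBoundary Ω) :
    ∃ U, IsOpen U ∧ frontier Ω ⊆ U ∧ ShiftBound Ω U := by
  have hc : IsCompact (frontier Ω) :=
    hb.isCompact_closure.of_isClosed_subset isClosed_frontier frontier_subset_closure
  refine hc.induction_on (p := fun s => ∃ U, IsOpen U ∧ s ⊆ U ∧ ShiftBound Ω U) ?_ ?_ ?_ ?_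
  · exact ⟨∅, isOpen_empty, subset_rfl, 0, fun δ _ => ⟨1, one_pos, fun k _ f _ _ => by simp⟩⟩
  · rintro s t hst ⟨U, hU, htU, h⟩
    exact ⟨U, hU, hst.trans htU, h⟩
  · rintro s t ⟨U, hU, hsU, h⟩ ⟨U', hU', htU', h'⟩
    exact ⟨U ∪ U', hU.union hU', union_subset_union hsU htU', h.union h'⟩
  · intro p hp
    obtain ⟨ρ, hρ, h⟩ := exists_shiftBound_ball hΩ hL hp
    exact ⟨Metric.ball p ρ, mem_nhdsWithin_of_mem_nhds (Metric.ball_mem_nhds p hρ), _,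
      Metric.isOpen_ball, subset_rfl, h⟩

/-- What `U` leaves uncovered in the closure of `Ω` is compact inside `Ω`, hence at positive
distance from the complement. Layers of width up to `δ₀` therefore lie in `U`. -/
theorem exists_shiftLayer_bound {Ω : Set (Space N)} (hΩ : IsOpen Ω)
    (hb : Bornology.IsBounded Ω) (hL : HasLipschitzBoundary Ω) :
    ∃ M : ℝ≥0, ∃ δ₀ > 0, ∀ δ > 0, δ ≤ δ₀ → ∃ r₀ > 0, ∀ k : Space N, ‖k‖ ≤ r₀ →
      ∀ f : Space N → ℝ, Integrable f → Measurable f →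
        ∫⁻ y in shiftLayer Ω δ k, ‖f (y + k) - f y‖ₑ ≤
          M * ‖k‖ₑ * totalVariation f 0 (boundaryLayer Ω (2 * δ)) := by
  obtain ⟨U, hU, hfU, M, hM⟩ := exists_shiftBound_frontier hΩ hb hL
  have hc : IsCompact (closure Ω \ U) := hb.isCompact_closure.diff hU
  have hsub : closure Ω \ U ⊆ Ω := by
    rintro x ⟨hx, hxU⟩
    by_contra hxΩ
    exact hxU (hfU (by rw [hΩ.frontier_eq]; exact ⟨hx, hxΩ⟩))
  obtain ⟨δ₀, hδ₀, hδΩ⟩ := hc.exists_cthickening_subset_open hΩ hsub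
  refine ⟨M, δ₀, hδ₀, fun δ hδ hδδ₀ => ?_⟩
  obtain ⟨r, hr, h⟩ := hM δ hδ
  refine ⟨r, hr, fun k hk f hf hfm => ?_⟩
  refine (lintegral_mono_set ?_).trans (h k hk f hf hfm)
  refine fun y hy => ⟨?_, hy⟩
  by_contra hyU
  obtain ⟨w, hw, hyw⟩ := Metric.mem_thickening_iff.1 hy.1.2
  exact hw (hδΩ (Metric.mem_cthickening_of_dist_le w y δ₀ _ ⟨subset_closure hy.1.1, hyU⟩
    (by rw [dist_comm]; exact hyw.le.trans hδδ₀)))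

/-! ### Spherical difference quotients and the lower bound -/

/-- The points of `Ω` that stay in `Ω` after the translation by `k`. -/
def shiftDomain (Ω : Set (Space N)) (k : Space N) : Set (Space N) := Ω ∩ {y | y + k ∈ Ω}

theorem isOpen_shiftDomain {Ω : Set (Space N)} (hΩ : IsOpen Ω) (k : Space N) :
    IsOpen (shiftDomain Ω k) := hΩ.inter (hΩ.preimage (continuous_add_const k))

/-- The spherical average of a kernel over the pairs of points of `Ω` at distance `r`. -/
def sphereEnergy (Ω : Set (Space N)) (F : Space N → Space N → ℝ≥0∞) (r : ℝ) : ℝ≥0∞ :=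
  ∫⁻ h : Metric.sphere (0 : Space N) 1,
    (∫⁻ y in shiftDomain Ω (r • (h : Space N)), F (r • (h : Space N)) y) ∂(sphereMeasure N)

/-- The spherical average of the difference quotients `|f(y + rh) - f(y) + rh · G(y)| / r`. -/
def sphereQuotient (Ω : Set (Space N)) (f : Space N → ℝ) (G : Space N → Space N) (r : ℝ) :
    ℝ≥0∞ :=
  (ENNReal.ofReal r)⁻¹ * sphereEnergy Ω (fun k y => ‖increment f G k y‖ₑ) r

theorem norm_smul_sphere {r : ℝ} (hr : 0 ≤ r) (h : Metric.sphere (0 : Space N) 1) :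
    ‖r • (h : Space N)‖ = r := by
  simp [norm_smul, abs_of_nonneg hr]

theorem measurable_setLIntegral_shiftDomain {Ω : Set (Space N)} (hΩ : IsOpen Ω)
    {X : Type*} [MeasurableSpace X] {k : X → Space N} (hk : Measurable k)
    {F : X → Space N → ℝ≥0∞} (hF : Measurable (Function.uncurry F)) :
    Measurable fun x => ∫⁻ y in shiftDomain Ω (k x), F x y := by
  have hs : MeasurableSet {p : X × Space N | p.2 ∈ shiftDomain Ω (k p.1)} :=
    (measurable_snd hΩ.measurableSet).inter
      ((measurable_snd.add (hk.comp measurable_fst)) hΩ.measurableSet)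
  have h := (hF.indicator hs).lintegral_prod_right' (ν := volume)
  convert h using 2 with x
  rw [← lintegral_indicator (isOpen_shiftDomain hΩ _).measurableSet]
  rfl

theorem tendsto_enorm_increment_div {g : Space N → ℝ} {H : Space N → Space N}
    (hg : ContDiff ℝ 1 g) (h y : Space N) :
    Tendsto (fun r : ℝ => (ENNReal.ofReal r)⁻¹ * ‖increment g H (r • h) y‖ₑ) (𝓝[>] 0)
      (𝓝 ‖(inner ℝ h (covGrad g H y) : ℝ)‖ₑ) := by
  have hd : HasDerivAt (fun r : ℝ => g (y + r • h)) (fderiv ℝ g y h) 0 := by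
    have h1 : HasDerivAt (fun s : ℝ => y + s • h) h 0 := by
      simpa using ((hasDerivAt_id (0 : ℝ)).smul_const h).const_add y
    have h2 : HasFDerivAt g (fderiv ℝ g y) (y + (0 : ℝ) • h) := by
      simpa using (hg.differentiable one_ne_zero y).hasFDerivAt
    exact h2.comp_hasDerivAt 0 h1
  have hs := ((hd.tendsto_slope_zero_right.add
    (tendsto_const_nhds (x := (inner ℝ h (H y) : ℝ)))).enorm)
  rw [real_inner_comm, inner_covGrad, real_inner_comm h]
  refine hs.congr' ?_
  filter_upwards [self_mem_nhdsWithin] with r hr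
  have hr0 : 0 < r := hr
  rw [← ENNReal.ofReal_inv_of_pos hr0, ← Real.enorm_of_nonneg (inv_nonneg.2 hr0.le),
    ← enorm_mul]
  congr 1
  simp only [increment, zero_add, zero_smul, add_zero, smul_eq_mul, real_inner_smul_left]
  field_simp

/-- Fatou in `y` and then in `h`, applied to the pointwise directional derivatives. -/
theorem lintegral_covGrad_le_liminf_increment {g : Space N → ℝ} {H : Space N → Space N}
    (hg : ContDiff ℝ 1 g) (hH : Continuous H) (K : Set (Space N)) :
    ∫⁻ h : Metric.sphere (0 : Space N) 1, (∫⁻ y in K,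
        ‖(inner ℝ (h : Space N) (covGrad g H y) : ℝ)‖ₑ) ∂(sphereMeasure N) ≤
      liminf (fun r : ℝ => (ENNReal.ofReal r)⁻¹ * ∫⁻ h : Metric.sphere (0 : Space N) 1,
        (∫⁻ y in K, ‖increment g H (r • (h : Space N)) y‖ₑ) ∂(sphereMeasure N)) (𝓝[>] 0) := by
  have hinc : ∀ r : ℝ, Measurable fun p : Metric.sphere (0 : Space N) 1 × Space N =>
      (ENNReal.ofReal r)⁻¹ * ‖increment g H (r • (p.1 : Space N)) p.2‖ₑ := fun r =>
    (((measurable_increment hg.continuous.measurable hH.measurable).comp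
      (f := fun p : Metric.sphere (0 : Space N) 1 × Space N => (r • (p.1 : Space N), p.2))
      (by fun_prop)).enorm).const_mul _
  have hin : ∀ (h : Metric.sphere (0 : Space N) 1) (r : ℝ), Measurable fun y : Space N =>
      (ENNReal.ofReal r)⁻¹ * ‖increment g H (r • (h : Space N)) y‖ₑ := fun h r =>
    (((measurable_increment hg.continuous.measurable hH.measurable).comp
      (f := fun y : Space N => (r • (h : Space N), y)) (by fun_prop)).enorm).const_mul _
  have hout : ∀ r : ℝ, Measurable fun h : Metric.sphere (0 : Space N) 1 => ∫⁻ y in K,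
      (ENNReal.ofReal r)⁻¹ * ‖increment g H (r • (h : Space N)) y‖ₑ := fun r =>
    (hinc r).lintegral_prod_right' (ν := volume.restrict K)
  have h1 : ∀ h : Metric.sphere (0 : Space N) 1, (∫⁻ y in K,
      ‖(inner ℝ (h : Space N) (covGrad g H y) : ℝ)‖ₑ) ≤ liminf (fun r : ℝ => ∫⁻ y in K,
        (ENNReal.ofReal r)⁻¹ * ‖increment g H (r • (h : Space N)) y‖ₑ) (𝓝[>] 0) := fun h => by
    refine le_trans (le_of_eq ?_) (lintegral_liminf_le (hin h))
    exact lintegral_congr fun y => (tendsto_enorm_increment_div hg h y).liminf_eq.symm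
  refine (lintegral_mono h1).trans ((lintegral_liminf_le hout).trans (liminf_le_liminf ?_))
  filter_upwards [self_mem_nhdsWithin] with r hr
  have hr0 : (ENNReal.ofReal r)⁻¹ ≠ ∞ := by simpa using hr
  rw [← lintegral_const_mul' _ _ hr0]
  exact lintegral_mono fun h => (lintegral_const_mul' _ _ hr0).le

/-- For `‖t‖, ‖k‖ ≤ η.rOut` both `y - t` and `y - t + k` lie within `2 * η.rOut` of `K`. Only pairs
inside `Ω` enter, so values of `f` outside `Ω` play no role. -/
theorem lintegral_increment_mollify_le (η : ContDiffBump (0 : Space N)) {f : Space N → ℝ}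
    {G : Space N → Space N} (hf : Integrable f) (hG : Integrable G) (hfm : Measurable f)
    (hGm : Measurable G) {K Ω : Set (Space N)} (hK : IsCompact K) (hΩ : IsOpen Ω)
    (hKΩ : Metric.cthickening (2 * η.rOut) K ⊆ Ω) {k : Space N} (hk : ‖k‖ ≤ η.rOut) :
    ∫⁻ y in K, ‖increment (mollify η f) (mollify η G) k y‖ₑ ≤
      ∫⁻ y in shiftDomain Ω k, ‖increment f G k y‖ₑ := by
  simp only [increment_mollify η hf hG]
  have hm : StronglyMeasurable (increment f G k) :=
    ((measurable_increment hfm hGm).comp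
      (measurable_const.prodMk measurable_id)).stronglyMeasurable
  refine lintegral_enorm_mollify_le η hm hK.measurableSet
    (isOpen_shiftDomain hΩ _).measurableSet fun y hy t ht => ?_
  refine ⟨hKΩ (Metric.mem_cthickening_of_dist_le _ y _ _ hy ?_),
    hKΩ (Metric.mem_cthickening_of_dist_le _ y _ _ hy ?_)⟩
  · rw [dist_eq_norm, sub_sub_cancel_left, norm_neg]
    linarith [η.rOut_pos]
  · rw [dist_eq_norm, show y - t + k - y = k - t by abel]
    refine (norm_sub_le _ _).trans ?_
    linarith

theorem lintegral_covGrad_le_liminf (η : ContDiffBump (0 : Space N)) {f : Space N → ℝ}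
    {G : Space N → Space N} (hf : Integrable f) (hG : Integrable G) (hfm : Measurable f)
    (hGm : Measurable G) {K Ω : Set (Space N)} (hK : IsCompact K) (hΩ : IsOpen Ω)
    (hKΩ : Metric.cthickening (2 * η.rOut) K ⊆ Ω) :
    ∫⁻ h : Metric.sphere (0 : Space N) 1, (∫⁻ y in K,
        ‖(inner ℝ (h : Space N) (covGrad (mollify η f) (mollify η G) y) : ℝ)‖ₑ)
        ∂(sphereMeasure N) ≤
      liminf (sphereQuotient Ω f G) (𝓝[>] 0) := by
  refine (lintegral_covGrad_le_liminf_increment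
    ((contDiff_mollify η hf).of_le (by exact_mod_cast le_top))
    (contDiff_mollify η hG).continuous K).trans (liminf_le_liminf ?_)
  filter_upwards [Ioo_mem_nhdsGT η.rOut_pos] with r hr
  refine mul_le_mul_right (lintegral_mono fun h => ?_) _
  exact lintegral_increment_mollify_le η hf hG hfm hGm hK hΩ hKΩ
    (by rw [norm_smul_sphere hr.1.le]; exact hr.2.le)

/-- For a fixed field `φ`, the pairing with the mollified pair is at most the mass of its covariant
gradient on `tsupport φ`, and `Q` times that mass is bounded by the `liminf`. The mollification is
removed only in the pairing. -/
theorem le_liminf_sphereQuotient (hN : 1 ≤ N) {ω : Space N} (hω : ‖ω‖ = 1) {f : Space N → ℝ}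
    {G : Space N → Space N} (hf : Integrable f) (hG : Integrable G) (hfm : Measurable f)
    (hGm : Measurable G) {Ω : Set (Space N)} (hΩ : IsOpen Ω) :
    ENNReal.ofReal (sphereConst ω) * totalVariation f G Ω ≤
      liminf (sphereQuotient Ω f G) (𝓝[>] 0) := by
  simp only [totalVariation, ENNReal.mul_iSup]
  refine iSup₂_le fun φ hφ => ?_
  have hlim := ENNReal.Tendsto.const_mul (ENNReal.tendsto_ofReal
    (tendsto_pairing_mollify tendsto_bumpSeq_rOut hf hG hφ.contDiff_one hφ.compact))
    (Or.inr (ENNReal.ofReal_ne_top (r := sphereConst ω)))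
  refine le_of_tendsto hlim ?_
  filter_upwards [eventually_cthickening_bumpSeq_subset hφ.compact hΩ hφ.support] with n hn
  refine le_trans ?_ (lintegral_covGrad_le_liminf (bumpSeq N n) hf hG hfm hGm hφ.compact hΩ hn)
  have hg1 : ContDiff ℝ 1 (mollify (bumpSeq N n) f) :=
    (contDiff_mollify (bumpSeq N n) hf).of_le (by exact_mod_cast le_top)
  have hH := (contDiff_mollify (bumpSeq N n) hG).continuous
  have hP := continuous_covGrad hg1 hH
  rw [lintegral_lintegral_swap (by
    refine (Continuous.measurable ?_).aemeasurable
    simp only [Function.uncurry_def]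
    fun_prop)]
  simp only [lintegral_sphere_enorm_inner hN hω]
  rw [lintegral_const_mul' _ _ ENNReal.ofReal_ne_top]
  gcongr
  rw [pairing_eq_neg_integral_inner_covGrad hg1 hH hφ.contDiff_one hφ.compact]
  refine (ENNReal.ofReal_le_ofReal (neg_le_abs _)).trans ?_
  rw [← Real.norm_eq_abs, ofReal_norm]
  refine (enorm_integral_le_lintegral_enorm _).trans ?_
  have hKm : MeasurableSet (tsupport φ) := (isClosed_tsupport φ).measurableSet
  rw [← lintegral_indicator hKm]
  refine lintegral_mono fun x => ?_
  by_cases hx : x ∈ tsupport φ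
  · rw [indicator_of_mem hx, ← ofReal_norm, ← ofReal_norm]
    refine ENNReal.ofReal_le_ofReal ((norm_inner_le_norm _ _).trans ?_)
    exact mul_le_of_le_one_right (norm_nonneg _) (hφ.bound x)
  · simp [image_eq_zero_of_notMem_tsupport hx]

/-! ### The upper bound and the limit for real pairs -/

theorem isCompact_diff_thickening {Ω : Set (Space N)} (hb : Bornology.IsBounded Ω) {δ : ℝ}
    (hδ : 0 < δ) : IsCompact (Ω \ Metric.thickening δ Ωᶜ) := by
  have h : Ω \ Metric.thickening δ Ωᶜ = (Metric.thickening δ Ωᶜ)ᶜ := by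
    ext x
    refine ⟨fun hx => hx.2, fun hx => ⟨?_, hx⟩⟩
    by_contra hxΩ
    exact hx (Metric.self_subset_thickening hδ _ hxΩ)
  refine Metric.isCompact_of_isClosed_isBounded ?_ (hb.subset sdiff_subset)
  rw [h]
  exact Metric.isOpen_thickening.isClosed_compl

theorem cthickening_diff_thickening_subset {Ω : Set (Space N)} (hb : Bornology.IsBounded Ω)
    {r δ : ℝ} (hr : 0 ≤ r) (hrδ : r < δ) :
    Metric.cthickening r (Ω \ Metric.thickening δ Ωᶜ) ⊆ Ω := by
  intro z hz
  rw [(isCompact_diff_thickening hb (hr.trans_lt hrδ)).cthickening_eq_biUnion_closedBall hr] at hz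
  obtain ⟨y, hy, hzy⟩ := mem_iUnion₂.1 hz
  by_contra hzΩ
  refine hy.2 (Metric.mem_thickening_iff.2 ⟨z, hzΩ, ?_⟩)
  rw [dist_comm]
  exact (Metric.mem_closedBall.1 hzy).trans_lt hrδ

/-- The points are split at distance `δ` from the complement, with `δ` fixed before `r`. The inner
part gives the main term and one `κ` from freezing `G`; the layer gives one `κ` from the variation
of `f` and one from the mass of `G`. -/
theorem eventually_sphereQuotient_le (hN : 1 ≤ N) {ω : Space N} (hω : ‖ω‖ = 1) {f : Space N → ℝ}
    {G : Space N → Space N} (hf : Integrable f) (hG : Integrable G) (hfm : Measurable f)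
    (hGm : Measurable G) {Ω : Set (Space N)} (hΩ : IsOpen Ω) (hb : Bornology.IsBounded Ω)
    (hL : HasLipschitzBoundary Ω) (hV : totalVariation f G Ω ≠ ∞) {κ : ℝ≥0∞} (hκ : κ ≠ 0) :
    ∀ᶠ r in 𝓝[>] 0, sphereQuotient Ω f G r ≤
      ENNReal.ofReal (sphereConst ω) * totalVariation f G Ω + sphereMeasure N univ * (3 * κ) := by
  have hGi : ∫⁻ y, ‖G y‖ₑ ≠ ∞ := hG.hasFiniteIntegral.ne
  have hV0 : totalVariation f 0 Ω ≠ ∞ :=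
    ne_top_of_le_ne_top (ENNReal.add_ne_top.2 ⟨hV, hGi⟩) (totalVariation_zero_le hf hG Ω)
  obtain ⟨M, δ₀, hδ₀, hM⟩ := exists_shiftLayer_bound hΩ hb hL
  -- The layer estimate multiplies the variation by `M`, so the target is divided in advance; `M +
  -- 1` avoids a zero divisor.
  have hκM : κ / (M + 1) ≠ 0 := by
    rw [Ne, ENNReal.div_eq_zero_iff, not_or]
    exact ⟨hκ, by simp⟩
  obtain ⟨δ₁, hδ₁, hV₁⟩ := exists_totalVariation_boundaryLayer_le hf (integrable_zero _ _ _) hΩ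
    hV0 hκM
  have hGlim := tendsto_lintegral_boundaryLayer hGm.enorm hGi hΩ
  -- The bound `δ₁ / 2` is there because the detours reach the layer of width `2 δ`.
  obtain ⟨δ, hδG, hδpos, hδ⟩ := ((hGlim.eventually (ge_mem_nhds
    (pos_iff_ne_zero.2 hκ))).and (Ioo_mem_nhdsGT (lt_min hδ₀ (half_pos hδ₁)))).exists
  obtain ⟨r₀, hr₀, hr₀M⟩ := hM δ hδpos (hδ.le.trans (min_le_left _ _))
  have hlayer : totalVariation f 0 (boundaryLayer Ω (2 * δ)) ≤ κ / (M + 1) := by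
    refine (totalVariation_mono f 0 ?_).trans hV₁
    refine inter_subset_inter_right _ (Metric.thickening_mono ?_ _)
    linarith [min_le_right δ₀ (δ₁ / 2)]
  have hMκ : M * (κ / (M + 1)) ≤ κ := by
    calc M * (κ / (M + 1)) ≤ (M + 1) * (κ / (M + 1)) := by gcongr; exact le_self_add
      _ ≤ κ := ENNReal.mul_div_le
  have htr := tendsto_lintegral_enorm_translate_sub hG
  obtain ⟨r₁, hr₁, hr₁G⟩ := Metric.eventually_nhds_iff.1
    (htr.eventually (ge_mem_nhds (pos_iff_ne_zero.2 hκ)))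
  filter_upwards [Ioo_mem_nhdsGT (lt_min hr₀ (lt_min hr₁ hδpos))] with r hr
  have hrr₀ : r ≤ r₀ := hr.2.le.trans (min_le_left _ _)
  have hrr₁ : r < r₁ := hr.2.trans_le ((min_le_right _ _).trans (min_le_left _ _))
  have hrδ : r < δ := hr.2.trans_le ((min_le_right _ _).trans (min_le_right _ _))
  have hr0 : ENNReal.ofReal r ≠ 0 := by simpa using hr.1
  rw [sphereQuotient, ← ENNReal.div_eq_inv_mul]
  refine ENNReal.div_le_of_le_mul' ?_
  have hint := lintegral_sphere_increment_le hN hω hf hG hGm.stronglyMeasurable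
    (isCompact_diff_thickening hb hδpos) hΩ hr.1.le
    (cthickening_diff_thickening_subset hb hr.1.le hrδ) (c := κ)
    fun k hk => hr₁G (by simpa using hk.trans_lt hrr₁)
  have hbd : ∀ h : Metric.sphere (0 : Space N) 1,
      ∫⁻ y in shiftLayer Ω δ (r • (h : Space N)), ‖increment f G (r • (h : Space N)) y‖ₑ ≤
        ENNReal.ofReal r * (2 * κ) := by
    intro h
    have hn : ‖r • (h : Space N)‖ₑ = ENNReal.ofReal r := by
      rw [← ofReal_norm, norm_smul_sphere hr.1.le]
    calc ∫⁻ y in shiftLayer Ω δ (r • (h : Space N)), ‖increment f G (r • (h : Space N)) y‖ₑ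
        ≤ ∫⁻ y in shiftLayer Ω δ (r • (h : Space N)),
            (‖f (y + r • (h : Space N)) - f y‖ₑ + ENNReal.ofReal r * ‖G y‖ₑ) := by
          refine lintegral_mono fun y => (enorm_add_le _ _).trans (add_le_add le_rfl ?_)
          rw [← hn, ← ofReal_norm, ← ofReal_norm, ← ofReal_norm,
            ← ENNReal.ofReal_mul (norm_nonneg _)]
          exact ENNReal.ofReal_le_ofReal (norm_inner_le_norm _ _)
      _ ≤ M * ENNReal.ofReal r * (κ / (M + 1)) + ENNReal.ofReal r * κ := by
          rw [lintegral_add_left (by fun_prop), lintegral_const_mul' _ _ ENNReal.ofReal_ne_top]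
          refine add_le_add ?_ ?_
          · refine (hr₀M _ (by rwa [norm_smul_sphere hr.1.le]) f hf hfm).trans ?_
            rw [hn]
            gcongr
          · gcongr
            exact (lintegral_mono_set inter_subset_left).trans hδG
      _ ≤ ENNReal.ofReal r * (2 * κ) := by
          rw [mul_comm (M : ℝ≥0∞), mul_assoc, ← mul_add, two_mul]
          gcongr
  calc sphereEnergy Ω (fun k y => ‖increment f G k y‖ₑ) r
      ≤ ∫⁻ h : Metric.sphere (0 : Space N) 1, ((∫⁻ y in Ω \ Metric.thickening δ Ωᶜ,
          ‖increment f G (r • (h : Space N)) y‖ₑ) + ENNReal.ofReal r * (2 * κ))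
          ∂(sphereMeasure N) := by
        refine lintegral_mono fun h => ?_
        refine le_trans ?_ (add_le_add le_rfl (hbd h))
        refine le_trans (lintegral_mono_set fun y hy => ?_) (lintegral_union_le _ _ _)
        by_cases hyδ : y ∈ Metric.thickening δ Ωᶜ
        · exact Or.inr ⟨⟨hy.1, hyδ⟩, hy.2⟩
        · exact Or.inl ⟨hy.1, hyδ⟩
    _ ≤ ENNReal.ofReal r * (ENNReal.ofReal (sphereConst ω) * totalVariation f G Ω +
          sphereMeasure N univ * κ) + ENNReal.ofReal r * (2 * κ) * sphereMeasure N univ := by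
        rw [lintegral_add_right _ measurable_const, lintegral_const]
        exact add_le_add hint le_rfl
    _ = _ := by ring

theorem tendsto_sphereQuotient (hN : 1 ≤ N) {ω : Space N} (hω : ‖ω‖ = 1) {f : Space N → ℝ}
    {G : Space N → Space N} (hf : Integrable f) (hG : Integrable G) (hfm : Measurable f)
    (hGm : Measurable G) {Ω : Set (Space N)} (hΩ : IsOpen Ω) (hb : Bornology.IsBounded Ω)
    (hL : HasLipschitzBoundary Ω) (hV : totalVariation f G Ω ≠ ∞) :
    Tendsto (sphereQuotient Ω f G) (𝓝[>] 0)
      (𝓝 (ENNReal.ofReal (sphereConst ω) * totalVariation f G Ω)) := by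
  refine tendsto_of_le_liminf_of_limsup_le (le_liminf_sphereQuotient hN hω hf hG hfm hGm hΩ) ?_
  have hlim : Tendsto (fun κ : ℝ≥0∞ => ENNReal.ofReal (sphereConst ω) * totalVariation f G Ω +
      sphereMeasure N univ * (3 * κ)) (𝓝[>] 0)
      (𝓝 (ENNReal.ofReal (sphereConst ω) * totalVariation f G Ω)) := by
    have h1 : Tendsto (fun κ : ℝ≥0∞ => 3 * κ) (𝓝 0) (𝓝 (3 * 0)) :=
      ENNReal.Tendsto.const_mul tendsto_id (Or.inr (by norm_num))
    have h2 := (ENNReal.Tendsto.const_mul h1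
      (Or.inr (measure_ne_top (sphereMeasure N) univ))).const_add
      (ENNReal.ofReal (sphereConst ω) * totalVariation f G Ω)
    simpa using h2.mono_left nhdsWithin_le_nhds
  refine ge_of_tendsto hlim (eventually_mem_nhdsWithin.mono fun κ hκ => ?_)
  exact limsup_le_of_le (h := eventually_sphereQuotient_le hN hω hf hG hfm hGm hΩ hb hL hV
    (ne_of_gt hκ))

/-! ### The double integral in polar coordinates -/

theorem sphereEnergy_mono {Ω : Set (Space N)} {F F' : Space N → Space N → ℝ≥0∞} {r : ℝ}
    (hΩ : IsOpen Ω) (h : ∀ z : Metric.sphere (0 : Space N) 1,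
      ∀ y ∈ shiftDomain Ω (r • (z : Space N)), F (r • (z : Space N)) y ≤ F' (r • (z : Space N)) y) :
    sphereEnergy Ω F r ≤ sphereEnergy Ω F' r :=
  lintegral_mono fun z => setLIntegral_mono' (isOpen_shiftDomain hΩ _).measurableSet (h z)

theorem sphereEnergy_add {Ω : Set (Space N)} (hΩ : IsOpen Ω) {F F' : Space N → Space N → ℝ≥0∞}
    (hF : Measurable (Function.uncurry F)) (r : ℝ) :
    sphereEnergy Ω (fun k y => F k y + F' k y) r = sphereEnergy Ω F r + sphereEnergy Ω F' r := by
  have hk : Measurable fun z : Metric.sphere (0 : Space N) 1 => r • (z : Space N) := by fun_prop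
  rw [sphereEnergy, sphereEnergy, sphereEnergy, ← lintegral_add_left
    (measurable_setLIntegral_shiftDomain hΩ hk (F := fun z y => F (r • (z : Space N)) y)
      (hF.comp ((hk.comp measurable_fst).prodMk measurable_snd)))]
  exact lintegral_congr fun z => lintegral_add_left (hF.comp (measurable_const.prodMk measurable_id)) _

theorem sphereEnergy_le_of_lintegral_le {Ω : Set (Space N)} {F : Space N → Space N → ℝ≥0∞}
    {c : ℝ≥0∞} (h : ∀ k, ∫⁻ y, F k y ≤ c) (r : ℝ) :
    sphereEnergy Ω F r ≤ c * sphereMeasure N univ := by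
  rw [← lintegral_const]
  exact lintegral_mono fun z => (setLIntegral_le_lintegral _ _).trans (h _)

/-- A double integral over `Ω × Ω` against a radial weight, in polar coordinates. -/
theorem lintegral_lintegral_radial (hN : 1 ≤ N) {Ω : Set (Space N)} (hΩ : IsOpen Ω)
    {F : Space N → Space N → ℝ≥0∞} (hF : Measurable (Function.uncurry F)) {w : ℝ → ℝ≥0∞}
    (hw : AEMeasurable w (volume.restrict (Ioi (0 : ℝ)))) :
    ∫⁻ y in Ω, ∫⁻ x in Ω, F (x - y) y * w ‖x - y‖ =
      ∫⁻ r in Ioi (0 : ℝ), ENNReal.ofReal (r ^ (N - 1)) * (w r * sphereEnergy Ω F r) := by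
  have := nontrivial_space hN
  obtain ⟨w', hw'm, hww'⟩ := hw
  have hae : ∀ᵐ k : Space N, w ‖k‖ = w' ‖k‖ := by
    filter_upwards [ae_norm_of_ae hN hww', Measure.ae_ne volume (0 : Space N)] with k hk hk0
    exact hk hk0
  have hstep : ∀ y, ∫⁻ x in Ω, F (x - y) y * w ‖x - y‖ =
      ∫⁻ k, {k | y + k ∈ Ω}.indicator (fun k => F k y * w' ‖k‖) k := by
    intro y
    rw [← lintegral_indicator hΩ.measurableSet, ← lintegral_add_right_eq_self _ y]
    refine lintegral_congr_ae (hae.mono fun k hk => ?_)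
    by_cases hky : k + y ∈ Ω
    · have hky' : y + k ∈ Ω := by rwa [add_comm]
      simp [hky, hky', hk]
    · have hky' : y + k ∉ Ω := by rwa [add_comm]
      simp [hky, hky']
  have hind : Measurable fun p : Space N × Space N =>
      {k | p.1 + k ∈ Ω}.indicator (fun k => F k p.1 * w' ‖k‖) p.2 := by
    have h1 : Measurable fun p : Space N × Space N => F p.2 p.1 * w' ‖p.2‖ :=
      (hF.comp measurable_swap).mul (hw'm.comp measurable_snd.norm)
    exact h1.indicator (s := {p : Space N × Space N | p.1 + p.2 ∈ Ω})
      ((measurable_fst.add measurable_snd) hΩ.measurableSet)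
  have hinner : ∀ k, ∫⁻ y in Ω, {k | y + k ∈ Ω}.indicator (fun k => F k y * w' ‖k‖) k =
      w' ‖k‖ * ∫⁻ y in shiftDomain Ω k, F k y := by
    intro k
    have hFk : Measurable (F k) := hF.comp (measurable_const.prodMk measurable_id)
    rw [← lintegral_const_mul _ hFk,
      ← lintegral_indicator hΩ.measurableSet,
      ← lintegral_indicator (isOpen_shiftDomain hΩ k).measurableSet]
    refine lintegral_congr fun y => ?_
    by_cases hy : y ∈ Ω <;> by_cases hyk : y + k ∈ Ω <;>
      simp [hy, hyk, shiftDomain, mul_comm]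
  have hm : Measurable fun k : Space N => w' ‖k‖ * ∫⁻ y in shiftDomain Ω k, F k y :=
    (hw'm.comp measurable_norm).mul (measurable_setLIntegral_shiftDomain hΩ measurable_id hF)
  simp only [hstep]
  rw [lintegral_lintegral_swap hind.aemeasurable]
  simp only [hinner]
  rw [lintegral_polar hN hm]
  refine lintegral_congr_ae ?_
  filter_upwards [hww', ae_restrict_mem measurableSet_Ioi] with r hr hr0
  have hk : Measurable fun z : Metric.sphere (0 : Space N) 1 => r • (z : Space N) := by fun_prop
  simp only [norm_smul_sphere (le_of_lt (show 0 < r from hr0))]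
  rw [hr, sphereEnergy, lintegral_const_mul _
    (measurable_setLIntegral_shiftDomain hΩ hk (F := fun z y => F (r • (z : Space N)) y)
      (hF.comp ((hk.comp measurable_fst).prodMk measurable_snd)))]

/-- The kernel `|u(y + k) - e^{i k · A(y + k/2)} u(y)|₁`. -/
def magneticKernel (A : Space N → Space N) (u : Space N → ℂ) (k y : Space N) : ℝ≥0∞ :=
  ENNReal.ofReal (norm1 (magneticDiff A u (y + k) y))

theorem ofReal_norm1 (z : ℂ) : ENNReal.ofReal (norm1 z) = ‖z.re‖ₑ + ‖z.im‖ₑ := by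
  rw [norm1, ENNReal.ofReal_add (abs_nonneg _) (abs_nonneg _), Real.enorm_eq_ofReal_abs,
    Real.enorm_eq_ofReal_abs]

theorem measurable_magneticKernel {A : Space N → Space N} (hA : Continuous A) {u : Space N → ℂ}
    (hu : Measurable u) : Measurable (Function.uncurry (magneticKernel A u)) := by
  have h : Measurable fun p : Space N × Space N => magneticDiff A u (p.2 + p.1) p.2 := by
    unfold magneticDiff
    have h1 : Measurable fun p : Space N × Space N => Complex.exp (Complex.I *
        ((inner ℝ (p.2 + p.1 - p.2) (A ((1 / 2 : ℝ) • (p.2 + p.1 + p.2))) : ℝ) : ℂ)) :=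
      Continuous.measurable (by fun_prop)
    exact (hu.comp (measurable_snd.add measurable_fst)).sub (h1.mul (hu.comp measurable_snd))
  simp only [Function.uncurry_def, magneticKernel, ofReal_norm1]
  exact (Complex.measurable_re.comp h).enorm.add (Complex.measurable_im.comp h).enorm

theorem energy_eq_lintegral (hN : 1 ≤ N) {A : Space N → Space N} (hA : Continuous A)
    {u : Space N → ℂ} (hu : Measurable u) {Ω : Set (Space N)} (hΩ : IsOpen Ω) {ρ : ℝ → ℝ}
    (hρ : AEMeasurable ρ (volume.restrict (Ioi (0 : ℝ)))) :
    energy A u Ω ρ = ∫⁻ r in Ioi (0 : ℝ), ENNReal.ofReal (ρ r * r ^ (N - 1)) *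
      ((ENNReal.ofReal r)⁻¹ * sphereEnergy Ω (magneticKernel A u) r) := by
  have hw : AEMeasurable (fun r => (ENNReal.ofReal r)⁻¹ * ENNReal.ofReal (ρ r))
      (volume.restrict (Ioi (0 : ℝ))) :=
    (ENNReal.measurable_ofReal.inv.aemeasurable).mul hρ.ennreal_ofReal
  have h := lintegral_lintegral_radial hN hΩ (measurable_magneticKernel hA hu) hw
  have h1 : energy A u Ω ρ = ∫⁻ y in Ω, ∫⁻ x in Ω, magneticKernel A u (x - y) y *
      ((ENNReal.ofReal ‖x - y‖)⁻¹ * ENNReal.ofReal (ρ ‖x - y‖)) := by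
    refine lintegral_congr fun y => lintegral_congr fun x => ?_
    rw [magneticKernel, add_sub_cancel]
    have hn1 : 0 ≤ norm1 (magneticDiff A u x y) := add_nonneg (abs_nonneg _) (abs_nonneg _)
    -- On the diagonal the difference vanishes, so the real quotient by `0` and the product with
    -- `0⁻¹ = ∞` are both `0`.
    rcases eq_or_ne x y with rfl | hxy
    · simp [magneticDiff, norm1]
    · have hpos : 0 < ‖x - y‖ := norm_pos_iff.2 (sub_ne_zero.2 hxy)
      rw [ENNReal.ofReal_mul (div_nonneg hn1 hpos.le), ENNReal.ofReal_div_of_pos hpos,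
        ENNReal.div_eq_inv_mul, mul_comm _ (ENNReal.ofReal (norm1 _)), mul_assoc]
  rw [h1, h]
  refine setLIntegral_congr_fun measurableSet_Ioi fun r hr => ?_
  have hr0 : 0 < r := hr
  rw [ENNReal.ofReal_mul' (pow_nonneg hr0.le _)]
  ring

/-! ### Linearization of the magnetic difference -/

/-- The first order part `u(y + k) - u(y) - i (k · A(y)) u(y)` of the magnetic difference. -/
def linearDiff (A : Space N → Space N) (u : Space N → ℂ) (k y : Space N) : ℂ :=
  u (y + k) - u y - Complex.I * ((inner ℝ k (A y) : ℝ) : ℂ) * u y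

theorem linearDiff_re (A : Space N → Space N) (u : Space N → ℂ) (k y : Space N) :
    (linearDiff A u k y).re =
      increment (fun x => (u x).re) (fun x => (u x).im • A x) k y := by
  simp [linearDiff, increment, real_inner_smul_right]
  ring

theorem linearDiff_im (A : Space N → Space N) (u : Space N → ℂ) (k y : Space N) :
    (linearDiff A u k y).im =
      increment (fun x => (u x).im) (fun x => -((u x).re • A x)) k y := by
  simp [linearDiff, increment, real_inner_smul_right]
  ring

theorem norm_exp_I_mul_sub_le (θ : ℝ) :
    ‖Complex.exp (Complex.I * θ) - 1 - Complex.I * θ‖ ≤ 3 * θ ^ 2 := by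
  have hn : ‖Complex.I * (θ : ℂ)‖ = |θ| := by simp
  -- Taylor's bound for `|θ| ≤ 1`; otherwise `2 + |θ| ≤ 3 θ²`.
  rcases le_total |θ| 1 with h | h
  · refine (Complex.norm_exp_sub_one_sub_id_le (by rwa [hn])).trans ?_
    rw [hn, sq_abs]
    nlinarith [sq_nonneg θ]
  · have h1 : ‖Complex.exp (Complex.I * θ)‖ = 1 := by
      rw [mul_comm]; exact Complex.norm_exp_ofReal_mul_I θ
    refine (norm_sub_le _ _).trans ?_
    refine (add_le_add_left (norm_sub_le _ _) _).trans ?_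
    rw [h1, hn, norm_one, ← sq_abs]
    nlinarith

/-- There are two second order errors: the Taylor remainder of the exponential, and the move of `A`
from the midpoint to `y`. -/
theorem norm_magneticDiff_sub_linearDiff_le {A : Space N → Space N} {u : Space N → ℂ}
    {B Λ : ℝ} {k y : Space N} (hB : ‖A ((1 / 2 : ℝ) • (y + k + y))‖ ≤ B)
    (hΛ : ‖A ((1 / 2 : ℝ) • (y + k + y)) - A y‖ ≤ Λ * ‖k‖) :
    ‖magneticDiff A u (y + k) y - linearDiff A u k y‖ ≤ (3 * B ^ 2 + Λ) * ‖k‖ ^ 2 * ‖u y‖ := by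
  set a := A ((1 / 2 : ℝ) • (y + k + y)) with ha
  have hθ : |(inner ℝ k a : ℝ)| ≤ ‖k‖ * B :=
    (abs_real_inner_le_norm _ _).trans (mul_le_mul_of_nonneg_left hB (norm_nonneg _))
  have h1 : magneticDiff A u (y + k) y - linearDiff A u k y =
      -((Complex.exp (Complex.I * ((inner ℝ k a : ℝ) : ℂ)) - 1 -
        Complex.I * ((inner ℝ k a : ℝ) : ℂ)) +
        Complex.I * ((inner ℝ k (a - A y) : ℝ) : ℂ)) * u y := by
    rw [magneticDiff, linearDiff, add_sub_cancel_left, ← ha, inner_sub_right]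
    push_cast
    ring
  rw [h1, norm_mul, norm_neg]
  gcongr
  refine (norm_add_le _ _).trans ?_
  have h2 : ‖Complex.I * ((inner ℝ k (a - A y) : ℝ) : ℂ)‖ ≤ ‖k‖ * (Λ * ‖k‖) := by
    rw [norm_mul, Complex.norm_I, one_mul, Complex.norm_real]
    exact (norm_inner_le_norm _ _).trans (mul_le_mul_of_nonneg_left hΛ (norm_nonneg _))
  have h3 : (inner ℝ k a : ℝ) ^ 2 ≤ (‖k‖ * B) ^ 2 := sq_le_sq' (by
    linarith [(abs_le.1 hθ).1]) (abs_le.1 hθ).2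
  have h4 := norm_exp_I_mul_sub_le (inner ℝ k a : ℝ)
  nlinarith

theorem exists_bound_lipschitz_of_isBounded {A : Space N → Space N} (hA : ContDiff ℝ 1 A)
    {Ω : Set (Space N)} (hb : Bornology.IsBounded Ω) :
    ∃ B Λ : ℝ, 0 ≤ B ∧ 0 ≤ Λ ∧ (∀ y ∈ Ω, ‖A y‖ ≤ B) ∧ ∀ k y : Space N, y ∈ Ω → y + k ∈ Ω →
      ‖A ((1 / 2 : ℝ) • (y + k + y))‖ ≤ B ∧
      ‖A ((1 / 2 : ℝ) • (y + k + y)) - A y‖ ≤ Λ * ‖k‖ := by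
  obtain ⟨R, hR⟩ := hb.subset_closedBall (0 : Space N)
  obtain ⟨B, hB⟩ := (isCompact_closedBall (0 : Space N) R).exists_bound_of_continuousOn
    hA.continuous.continuousOn
  obtain ⟨Λ, hΛ⟩ := (isCompact_closedBall (0 : Space N) R).exists_bound_of_continuousOn
    (hA.continuous_fderiv one_ne_zero).continuousOn
  refine ⟨max B 0, max Λ 0, le_max_right _ _, le_max_right _ _,
    fun y hy => (hB y (hR hy)).trans (le_max_left _ _), fun k y hy hyk => ?_⟩
  -- The midpoint may leave `Ω` but not a ball containing `Ω`; convexity of the ball also serves the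
  -- mean value inequality.
  have hmid : (1 / 2 : ℝ) • (y + k + y) ∈ Metric.closedBall (0 : Space N) R := by
    have := convex_closedBall (0 : Space N) R (hR hyk) (hR hy)
      (show (0 : ℝ) ≤ 1 / 2 by norm_num) (show (0 : ℝ) ≤ 1 / 2 by norm_num) (by norm_num)
    rwa [← smul_add] at this
  refine ⟨(hB _ hmid).trans (le_max_left _ _), ?_⟩
  have h := (convex_closedBall (0 : Space N) R).norm_image_sub_le_of_norm_fderiv_le
    (𝕜 := ℝ) (fun x _ => hA.differentiable one_ne_zero x) hΛ (hR hy) hmid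
  refine h.trans ?_
  have h2 : (1 / 2 : ℝ) • (y + k + y) - y = (1 / 2 : ℝ) • k := by module
  rw [h2, norm_smul]
  have h3 : ‖(1 / 2 : ℝ)‖ * ‖k‖ ≤ ‖k‖ :=
    mul_le_of_le_one_left (norm_nonneg _) (by norm_num)
  exact mul_le_mul (le_max_left _ _) h3 (by positivity) (le_max_right _ _)

theorem ofReal_norm1_le (z w : ℂ) :
    ENNReal.ofReal (norm1 z) ≤ ENNReal.ofReal (norm1 w) + 2 * ‖z - w‖ₑ := by
  have hw : 0 ≤ norm1 w := add_nonneg (abs_nonneg _) (abs_nonneg _)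
  rw [← ofReal_norm, show (2 : ℝ≥0∞) = ENNReal.ofReal 2 by simp,
    ← ENNReal.ofReal_mul (by norm_num), ← ENNReal.ofReal_add hw (by positivity)]
  refine ENNReal.ofReal_le_ofReal ?_
  have h1 := Complex.abs_re_le_norm (z - w)
  have h2 := Complex.abs_im_le_norm (z - w)
  have h3 := abs_sub_abs_le_abs_sub z.re w.re
  have h4 := abs_sub_abs_le_abs_sub z.im w.im
  rw [Complex.sub_re] at h1
  rw [Complex.sub_im] at h2
  unfold norm1
  linarith

theorem ofReal_norm1_magneticDiff_le (A : Space N → Space N) (u : Space N → ℂ) (x y : Space N) :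
    ENNReal.ofReal (norm1 (magneticDiff A u x y)) ≤ 2 * ‖u x‖ₑ + 2 * ‖u y‖ₑ := by
  have h := ofReal_norm1_le (magneticDiff A u x y) 0
  rw [show norm1 0 = 0 by simp [norm1], ENNReal.ofReal_zero, zero_add, sub_zero] at h
  refine h.trans ?_
  rw [← mul_add]
  gcongr
  refine enorm_sub_le.trans_eq ?_
  rw [enorm_mul, ← ofReal_norm (Complex.exp _), mul_comm Complex.I, Complex.norm_exp_ofReal_mul_I,
    ENNReal.ofReal_one, one_mul]

/-- The difference quotients of the magnetic differences, averaged over spheres. -/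
def magneticQuotient (Ω : Set (Space N)) (A : Space N → Space N) (u : Space N → ℂ) (r : ℝ) :
    ℝ≥0∞ :=
  (ENNReal.ofReal r)⁻¹ * sphereEnergy Ω (magneticKernel A u) r

/-- The phase has modulus one, so the kernel is dominated by `2 |u(y + k)| + 2 |u(y)|`. This is the
bound away from `r = 0` that `tendsto_lintegral_mul_of_concentrating` requires. -/
theorem magneticQuotient_le {Ω : Set (Space N)} (A : Space N → Space N) {u : Space N → ℂ}
    (hu : Measurable u) {δ r : ℝ} (hr : δ < r) :
    magneticQuotient Ω A u r ≤ (ENNReal.ofReal δ)⁻¹ *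
      ((2 * (∫⁻ y, ‖u y‖ₑ) + 2 * ∫⁻ y, ‖u y‖ₑ) * sphereMeasure N univ) := by
  refine mul_le_mul' (ENNReal.inv_le_inv.2 (ENNReal.ofReal_le_ofReal hr.le))
    (sphereEnergy_le_of_lintegral_le (fun k => ?_) r)
  refine (lintegral_mono fun y => ofReal_norm1_magneticDiff_le A u (y + k) y).trans_eq ?_
  rw [lintegral_add_left (by fun_prop), lintegral_const_mul _ (by fun_prop),
    lintegral_const_mul _ (by fun_prop), lintegral_add_right_eq_self (fun y => ‖u y‖ₑ) k]

section Comparison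

variable {Ω : Set (Space N)} {A : Space N → Space N} {u : Space N → ℂ}

theorem exists_magneticKernel_bound (hA : ContDiff ℝ 1 A) (hb : Bornology.IsBounded Ω) :
    ∃ C : ℝ≥0∞, C ≠ ∞ ∧ ∀ r : ℝ, 0 ≤ r → ∀ (h : Metric.sphere (0 : Space N) 1),
      ∀ y ∈ shiftDomain Ω (r • (h : Space N)),
        2 * ‖magneticDiff A u (y + r • (h : Space N)) y - linearDiff A u (r • (h : Space N)) y‖ₑ ≤
          C * ENNReal.ofReal r ^ 2 * ‖u y‖ₑ := by
  obtain ⟨B, Λ, hB0, hΛ0, -, h⟩ := exists_bound_lipschitz_of_isBounded hA hb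
  refine ⟨2 * ENNReal.ofReal (3 * B ^ 2 + Λ), ENNReal.mul_ne_top (by norm_num)
    ENNReal.ofReal_ne_top, fun r hr z y hy => ?_⟩
  obtain ⟨h1, h2⟩ := h (r • (z : Space N)) y hy.1 hy.2
  have h3 := norm_magneticDiff_sub_linearDiff_le (u := u) h1 h2
  rw [norm_smul_sphere hr] at h3
  rw [mul_assoc, mul_assoc]
  gcongr
  rw [← ofReal_norm, ← ofReal_norm, ← ENNReal.ofReal_pow hr, ← ENNReal.ofReal_mul (by positivity),
    ← ENNReal.ofReal_mul (by positivity), ← mul_assoc]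
  exact ENNReal.ofReal_le_ofReal h3

/-- The covariant potential of the real part. -/
abbrev potentialRe (A : Space N → Space N) (u : Space N → ℂ) (x : Space N) : Space N :=
  (u x).im • A x

/-- The covariant potential of the imaginary part. -/
abbrev potentialIm (A : Space N → Space N) (u : Space N → ℂ) (x : Space N) : Space N :=
  -((u x).re • A x)

theorem sphereQuotient_add_sphereQuotient (hΩ : IsOpen Ω) (hA : Continuous A)
    (hu : Measurable u) (r : ℝ) :
    sphereQuotient Ω (fun x => (u x).re) (potentialRe A u) r +
      sphereQuotient Ω (fun x => (u x).im) (potentialIm A u) r =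
    (ENNReal.ofReal r)⁻¹ *
      sphereEnergy Ω (fun k y => ENNReal.ofReal (norm1 (linearDiff A u k y))) r := by
  have hm : Measurable (Function.uncurry fun k y =>
      ‖increment (fun x => (u x).re) (potentialRe A u) k y‖ₑ) :=
    (measurable_increment (Complex.measurable_re.comp hu)
      ((Complex.measurable_im.comp hu).smul hA.measurable)).enorm
  rw [sphereQuotient, sphereQuotient, ← mul_add, ← sphereEnergy_add hΩ hm]
  simp only [ofReal_norm1, linearDiff_re, linearDiff_im]

/-- The kernel error is at most `C r² |u(y)|`; after division by `r` it is `O(r)` and does not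
affect the limit. -/
theorem exists_magneticQuotient_compare (hΩ : IsOpen Ω) (hb : Bornology.IsBounded Ω)
    (hA : ContDiff ℝ 1 A) (hu : Measurable u) (hui : Integrable u) :
    ∃ C : ℝ≥0∞, C ≠ ∞ ∧ ∀ r : ℝ, 0 < r →
      magneticQuotient Ω A u r ≤ (sphereQuotient Ω (fun x => (u x).re) (potentialRe A u) r +
        sphereQuotient Ω (fun x => (u x).im) (potentialIm A u) r) + C * ENNReal.ofReal r ∧
      sphereQuotient Ω (fun x => (u x).re) (potentialRe A u) r +
        sphereQuotient Ω (fun x => (u x).im) (potentialIm A u) r ≤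
          magneticQuotient Ω A u r + C * ENNReal.ofReal r := by
  obtain ⟨C, hC, h⟩ := exists_magneticKernel_bound (u := u) hA hb
  refine ⟨C * (∫⁻ y, ‖u y‖ₑ) * sphereMeasure N univ, ENNReal.mul_ne_top (ENNReal.mul_ne_top hC
    hui.hasFiniteIntegral.ne) (measure_ne_top _ _), fun r hr => ?_⟩
  have herr : (ENNReal.ofReal r)⁻¹ *
      sphereEnergy Ω (fun _ y => C * ENNReal.ofReal r ^ 2 * ‖u y‖ₑ) r ≤
      C * (∫⁻ y, ‖u y‖ₑ) * sphereMeasure N univ * ENNReal.ofReal r := by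
    have hr0 : ENNReal.ofReal r ≠ 0 := by simpa using hr
    refine (mul_le_mul_right (sphereEnergy_le_of_lintegral_le (fun k =>
      (lintegral_const_mul _ (by fun_prop)).le) r) _).trans_eq ?_
    calc _ = ((ENNReal.ofReal r)⁻¹ * ENNReal.ofReal r) *
          (C * (∫⁻ y, ‖u y‖ₑ) * sphereMeasure N univ * ENNReal.ofReal r) := by ring
      _ = _ := by rw [ENNReal.inv_mul_cancel hr0 ENNReal.ofReal_ne_top, one_mul]
  have hAc := hA.continuous
  have hml : Measurable (Function.uncurry fun k y =>
      ENNReal.ofReal (norm1 (linearDiff A u k y))) := by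
    simp only [Function.uncurry_def, ofReal_norm1, linearDiff_re, linearDiff_im]
    exact (measurable_increment (Complex.measurable_re.comp hu)
      ((Complex.measurable_im.comp hu).smul hAc.measurable)).enorm.add
      (measurable_increment (Complex.measurable_im.comp hu)
      ((Complex.measurable_re.comp hu).smul hAc.measurable).neg).enorm
  rw [sphereQuotient_add_sphereQuotient hΩ hAc hu, magneticQuotient]
  constructor
  · refine le_trans ?_ (add_le_add_right herr _)
    rw [← mul_add, ← sphereEnergy_add hΩ hml]
    refine mul_le_mul_right (sphereEnergy_mono hΩ fun z y hy => ?_) _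
    exact (ofReal_norm1_le _ _).trans (add_le_add_right (h r hr.le z y hy) _)
  · refine le_trans ?_ (add_le_add_right herr _)
    rw [← mul_add, ← sphereEnergy_add hΩ (measurable_magneticKernel hAc hu)]
    refine mul_le_mul_right (sphereEnergy_mono hΩ fun z y hy => ?_) _
    refine (ofReal_norm1_le _ _).trans (add_le_add_right ?_ _)
    rw [← enorm_neg, neg_sub]
    exact h r hr.le z y hy

/-! ### Zero extension and conclusion -/

theorem integrable_smul_of_eq_zero_off (hb : Bornology.IsBounded Ω) (hA : ContDiff ℝ 1 A)
    {v : Space N → ℝ} (hv : Integrable v) (h0 : ∀ x ∉ Ω, v x = 0) :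
    Integrable fun x => v x • A x := by
  obtain ⟨B, -, hB0, -, hB, -⟩ := exists_bound_lipschitz_of_isBounded hA hb
  refine (hv.norm.mul_const B).mono' (hv.aestronglyMeasurable.smul
    hA.continuous.aestronglyMeasurable) (Eventually.of_forall fun x => ?_)
  rw [norm_smul]
  by_cases hx : x ∈ Ω
  · gcongr
    exact hB x hx
  · simp [h0 x hx]

/-- For `u` vanishing off `Ω` the integral over `Ω` is one over the whole space. The test fields
stay supported in `Ω`, so a jump of `u` across the boundary is not counted. -/
theorem variationRe_eq_totalVariation (h0 : ∀ x ∉ Ω, u x = 0) :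
    variationRe A u Ω = totalVariation (fun x => (u x).re) (potentialRe A u) Ω := by
  rw [variationRe, totalVariation]
  refine iSup_congr fun φ => iSup_congr fun _ => ?_
  rw [pairing, setIntegral_eq_integral_of_forall_compl_eq_zero fun x hx => by simp [h0 x hx]]
  simp only [potentialRe, real_inner_smul_left, mul_comm]

theorem variationIm_eq_totalVariation (h0 : ∀ x ∉ Ω, u x = 0) :
    variationIm A u Ω = totalVariation (fun x => (u x).im) (potentialIm A u) Ω := by
  rw [variationIm, totalVariation]
  refine iSup_congr fun φ => iSup_congr fun _ => ?_
  rw [pairing, setIntegral_eq_integral_of_forall_compl_eq_zero fun x hx => by simp [h0 x hx]]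
  simp only [potentialIm, inner_neg_left, real_inner_smul_left, mul_comm, sub_neg_eq_add]

theorem tendsto_magneticQuotient (hN : 1 ≤ N) {ω : Space N} (hω : ‖ω‖ = 1) (hΩ : IsOpen Ω)
    (hb : Bornology.IsBounded Ω) (hL : HasLipschitzBoundary Ω) (hA : ContDiff ℝ 1 A)
    (hu : Measurable u) (hui : Integrable u) (h0 : ∀ x ∉ Ω, u x = 0)
    (hV : variation A u Ω ≠ ∞) :
    Tendsto (magneticQuotient Ω A u) (𝓝[>] 0)
      (𝓝 (ENNReal.ofReal (sphereConst ω) * variation A u Ω)) := by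
  rw [variation, variationRe_eq_totalVariation h0, variationIm_eq_totalVariation h0,
    ENNReal.add_ne_top] at hV
  have hre : Integrable fun x => (u x).re := hui.re
  have him : Integrable fun x => (u x).im := hui.im
  have hmre : Measurable fun x => (u x).re := Complex.measurable_re.comp hu
  have hmim : Measurable fun x => (u x).im := Complex.measurable_im.comp hu
  have h1 := tendsto_sphereQuotient hN hω hre
    (integrable_smul_of_eq_zero_off hb hA him fun x hx => by simp [h0 x hx]) hmre
    (hmim.smul hA.continuous.measurable) hΩ hb hL hV.1
  have h2 := tendsto_sphereQuotient hN hω him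
    (integrable_smul_of_eq_zero_off hb hA hre fun x hx => by simp [h0 x hx]).neg hmim
    (hmre.smul hA.continuous.measurable).neg hΩ hb hL hV.2
  have h12 := h1.add h2
  rw [← mul_add] at h12
  obtain ⟨C, hC, hcomp⟩ := exists_magneticQuotient_compare hΩ hb hA hu hui
  have herr : Tendsto (fun r : ℝ => C * ENNReal.ofReal r) (𝓝[>] 0) (𝓝 0) := by
    have : Tendsto (fun r : ℝ => C * ENNReal.ofReal r) (𝓝 0) (𝓝 (C * ENNReal.ofReal 0)) :=
      ENNReal.Tendsto.const_mul (ENNReal.tendsto_ofReal tendsto_id) (Or.inr hC)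
    simpa using this.mono_left nhdsWithin_le_nhds
  rw [variation, variationRe_eq_totalVariation h0, variationIm_eq_totalVariation h0]
  have hlow := ENNReal.Tendsto.sub h12 herr (Or.inr ENNReal.zero_ne_top)
  have hup := h12.add herr
  rw [tsub_zero] at hlow
  rw [add_zero] at hup
  refine tendsto_of_tendsto_of_tendsto_of_le_of_le' hlow hup ?_ ?_
  · filter_upwards [self_mem_nhdsWithin] with r hr
    exact tsub_le_iff_right.2 (hcomp r hr).2
  · filter_upwards [self_mem_nhdsWithin] with r hr
    exact (hcomp r hr).1

theorem tendsto_energy_of_measurable (hN : 1 ≤ N) {ω : Space N} (hω : ‖ω‖ = 1) (hΩ : IsOpen Ω)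
    (hb : Bornology.IsBounded Ω) (hL : HasLipschitzBoundary Ω) (hA : ContDiff ℝ 1 A)
    (hu : Measurable u) (hui : Integrable u) (h0 : ∀ x ∉ Ω, u x = 0)
    (hV : variation A u Ω ≠ ∞) {ρ : ℕ → ℝ → ℝ}
    (hρm : ∀ m, AEMeasurable (ρ m) (volume.restrict (Ioi (0 : ℝ))))
    (hρ1 : Tendsto (fun m => ∫⁻ r in Ioi (0 : ℝ), ENNReal.ofReal (ρ m r * r ^ (N - 1)))
      atTop (𝓝 1))
    (hρδ : ∀ δ : ℝ, 0 < δ →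
      Tendsto (fun m => ∫⁻ r in Ioi δ, ENNReal.ofReal (ρ m r * r ^ (N - 1))) atTop (𝓝 0)) :
    Tendsto (fun m => energy A u Ω (ρ m)) atTop
      (𝓝 (ENNReal.ofReal (sphereConst ω) * variation A u Ω)) := by
  simp only [energy_eq_lintegral hN hA.continuous hu hΩ (hρm _)]
  refine tendsto_lintegral_mul_of_concentrating hρ1 hρδ
    (tendsto_magneticQuotient hN hω hΩ hb hL hA hu hui h0 hV) fun δ hδ =>
    ⟨_, ?_, fun r hr => magneticQuotient_le A hu hr⟩
  have hfin : ∫⁻ y, ‖u y‖ₑ ≠ ∞ := hui.hasFiniteIntegral.ne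
  refine ENNReal.mul_ne_top (by simpa using hδ) (ENNReal.mul_ne_top ?_ (measure_ne_top _ _))
  exact ENNReal.add_ne_top.2 ⟨ENNReal.mul_ne_top (by norm_num) hfin,
    ENNReal.mul_ne_top (by norm_num) hfin⟩

end Comparison

theorem energy_congr (A : Space N → Space N) {u v : Space N → ℂ} {Ω : Set (Space N)}
    (h : u =ᵐ[volume.restrict Ω] v) (ρ : ℝ → ℝ) : energy A u Ω ρ = energy A v Ω ρ := by
  refine lintegral_congr_ae (h.mono fun y hy => lintegral_congr_ae (h.mono fun x hx => ?_))
  simp only [magneticDiff, hx, hy]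

theorem variation_congr (A : Space N → Space N) {u v : Space N → ℂ} {Ω : Set (Space N)}
    (h : u =ᵐ[volume.restrict Ω] v) : variation A u Ω = variation A v Ω := by
  rw [variation, variation, variationRe, variationRe, variationIm, variationIm]
  congr 1 <;> refine iSup_congr fun φ => iSup_congr fun _ => ?_ <;> congr 1 <;>
    exact integral_congr_ae (h.mono fun x hx => by simp only [hx])

end MagneticBV

end

theorem mainTheorem2 (N : ℕ) (hN : 1 ≤ N)
    (Ω : Set (MagneticBV.Space N)) (hΩo : IsOpen Ω) (hΩb : Bornology.IsBounded Ω)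
    (hΩL : MagneticBV.HasLipschitzBoundary Ω)
    (A : MagneticBV.Space N → MagneticBV.Space N) (hA : ContDiff ℝ 2 A)
    (u : MagneticBV.Space N → ℂ) (hu : MagneticBV.MemBV A u Ω)
    (ρ : ℕ → ℝ → ℝ)
    (hρm : ∀ m, AEMeasurable (ρ m) (volume.restrict (Ioi (0 : ℝ))))
    (hρ0 : ∀ m r, 0 < r → 0 ≤ ρ m r)
    (hρ1 : Tendsto (fun m => ∫⁻ r in Ioi (0 : ℝ), ENNReal.ofReal (ρ m r * r ^ (N - 1)))
      atTop (𝓝 1))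
    (hρδ : ∀ δ : ℝ, 0 < δ →
      Tendsto (fun m => ∫⁻ r in Ioi δ, ENNReal.ofReal (ρ m r * r ^ (N - 1))) atTop (𝓝 0))
    (ω : MagneticBV.Space N) (hω : ‖ω‖ = 1) :
    Tendsto (fun m => MagneticBV.energy A u Ω (ρ m)) atTop
      (𝓝 (ENNReal.ofReal (MagneticBV.sphereConst ω) * MagneticBV.variation A u Ω)) := by
  open MagneticBV in
  have hum := hu.1.aestronglyMeasurable
  -- Neither the energy nor the variation sees changes of `u` off `Ω` or on null sets, so `u` may be
  -- taken Borel, globally integrable and zero off `Ω`.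
  set v : Space N → ℂ := Ω.indicator (hum.mk u) with hv
  have huv : u =ᵐ[volume.restrict Ω] v :=
    hum.ae_eq_mk.trans (indicator_ae_eq_restrict hΩo.measurableSet).symm
  have hvm : Measurable v := hum.stronglyMeasurable_mk.measurable.indicator hΩo.measurableSet
  have hvi : Integrable v :=
    (integrable_indicator_iff hΩo.measurableSet).2 (hu.1.congr hum.ae_eq_mk)
  have hV : variation A v Ω ≠ ∞ := by
    rw [← variation_congr A huv]
    exact hu.2.ne
  simp only [energy_congr A huv, variation_congr A huv]
  exact tendsto_energy_of_measurable hN hω hΩo hΩb hΩL (hA.of_le (by norm_num)) hvm hvi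
    (fun x hx => indicator_of_notMem hx _) hV hρm hρ1 hρδ
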